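/- Let $\mathcal H$ be an infinite-dimensional separable complex Hilbert space and let $A$ be a normal operator on $\mathcal H$ with compact resolvent which generates a $C_0$-semigroup $\{e^{-tA}\}_{t\ge 0}$ (sign convention: $Ax=\lim_{t\downarrow 0}t^{-1}(x-e^{-tA}x)$). Let $\mathcal R A$ be the self-adjoint operator $\overline{\tfrac12(A+A^*)}$, let $N(\lambda)=N_{\mathcal R A}(\lambda)\in[0,\infty]$ be the number of eigenvalues of $\mathcal R A$ in $(-\infty,\lambda]$, counted with multiplicity, and let $\lambda_1\le\lambda_2\le\cdots$ be the eigenvalues of $\mathcal R A$ repeated according to multiplicity, whenever they can be enumerated in this way. Let $\|T\|_1\in[0,\infty]$ be the trace norm (the sum of the singular values if $T$ is compact, and $\infty$ otherwise). The semigroup is called a Gibbs semigroup if $\|e^{-tA}\|_1<\infty$ for all $t>0$. Put $\mathrm{Ln}_0(x)=x$, $\mathrm{Ln}_{k+1}(x)=\ln(1+\mathrm{Ln}_k(x))$, and $\ln^{\circ k}=\ln\circ\cdots\circ\ln$ ($k$ times). For $y\ge 0$ let $W_0(y)$ be the $x\ge 0$ with $xe^x=y$. For $g>0$, $F=O(g)$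 means $\limsup F/g<\infty$. (a) Let $p>0$ and $r\in\mathbb R$, or $p=0$ and $r>0$, and let $k\ge 1$ be an integer. The following are equivalent: (i) $\{e^{-tA}\}_{t\ge0}$ is a Gibbs semigroup and $\|e^{-tA}\|_1=O\big(t^{-p}(\mathrm{Ln}_k t^{-1})^r\big)$ as $t\downarrow 0$; (ii) $\mathcal R A\ne 0$ and $N(\lambda)=O\big(\lambda^p(\mathrm{Ln}_k\lambda)^r\big)$ as $\lambda\to\infty$; (ii') (if $k=1$) $\mathcal R A\neq 0$ and $N(e^{W_0(\lambda)})=O\big(\lambda^r e^{(p-r)W_0(\lambda)}\big)$ as $\lambda\to\infty$; (iii) (if $r=0$) $\mathcal R A\ne0$, the enumeration $(\lambda_j)_{j\ge1}$ exists, $\lambda_j\neq 0$ for all large $j$, and $\lambda_j^{-1}=O(j^{-1/p})$ as $j\to\infty$. (b) Let $p\ge 0$ and let $f:(0,\infty)\to(0,\infty)$ be Lebesgue measurable and regularly varying with index $p$, i.e. $\lim_{t\to\infty}f(tx)/f(t)=x^p$ for all $x>0$. (iv) For every $c\in\mathbb R$, if $\liminf_{\lambda\to\infty}N(\lambda)/f(\lambda)\ge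 c$, then $\liminf_{t\downarrow 0}\|e^{-tA}\|_1/f(t^{-1})\ge c\,\Gamma(1+p)$. (v) If $\liminf_{t\downarrow0}\|e^{-tA}\|_1/f(t^{-1})>0$ and $\|e^{-tA}\|_1=O(f(t^{-1}))$ as $t\downarrow 0$, then $\liminf_{\lambda\to\infty}N(\lambda)/f(\lambda)>0$. (c) Let $p>0$ and $r\in\mathbb R$, or $p=0$ and $r>0$, and let $k\ge1$ be an integer. For every $C\in[0,\infty)$ the following are equivalent: (vi) $N(\lambda)\sim C\,\lambda^p(\ln^{\circ k}\lambda)^r$ as $\lambda\to\infty$, i.e. $N(\lambda)\big/\big(\lambda^p(\ln^{\circ k}\lambda)^r\big)\to C$; (vii) $\|e^{-tA}\|_1\sim\Gamma(1+p)\,C\,t^{-p}(\ln^{\circ k}t^{-1})^r$ as $t\downarrow0$, i.e. $\|e^{-tA}\|_1\big/\big(t^{-p}(\ln^{\circ k}t^{-1})^r\big)\to\Gamma(1+p)\,C$. -/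

import Mathlib

open Filter Topology
open scoped ENNReal

noncomputable section

namespace GibbsKaramata

/-- The iterated logarithm `Ln_0 x = x`, `Ln_{k+1} x = ln (1 + Ln_k x)`. -/
def Ln : ℕ → ℝ → ℝ
  | 0, x => x
  | k + 1, x => Real.log (1 + Ln k x)

/-- The `k`-fold composition `ln ∘ ⋯ ∘ ln`. -/
def lnIter (k : ℕ) (x : ℝ) : ℝ := Real.log^[k] x

/-- The principal branch of the Lambert function on `[0, ∞)`: for `y ≥ 0`, `lambertW₀ y` is the
unique `x ≥ 0` with `x * exp x = y`. -/
def lambertW₀ (y : ℝ) : ℝ := Function.invFunOn (fun x : ℝ => x * Real.exp x) (Set.Ici 0) y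

theorem lambertW₀_spec {y : ℝ} (hy : 0 ≤ y) :
    0 ≤ lambertW₀ y ∧ lambertW₀ y * Real.exp (lambertW₀ y) = y := by
  have h : ∃ x ∈ Set.Ici (0 : ℝ), (fun x : ℝ => x * Real.exp x) x = y := by
    have hc : ContinuousOn (fun x : ℝ => x * Real.exp x) (Set.Icc 0 y) := by fun_prop
    have hmem : y ∈ Set.Icc ((0 : ℝ) * Real.exp 0) (y * Real.exp y) := by
      refine ⟨by simpa using hy, ?_⟩
      nlinarith [Real.one_le_exp hy]
    obtain ⟨x, hx, hxy⟩ := intermediate_value_Icc hy hc hmem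
    exact ⟨x, hx.1, hxy⟩
  exact Function.invFunOn_pos h

/-- `f : (0,∞) → (0,∞)` is Lebesgue measurable and regularly varying at infinity with index `p`.
Only the values of `f` on `(0,∞)` matter. -/
structure IsRegularlyVarying (f : ℝ → ℝ) (p : ℝ) : Prop where
  measurable : AEMeasurable f (MeasureTheory.volume.restrict (Set.Ioi 0))
  pos : ∀ x, 0 < x → 0 < f x
  tendsto : ∀ x, 0 < x → Tendsto (fun t => f (t * x) / f t) atTop (𝓝 (x ^ p))

variable {H : Type*} [NormedAddCommGroup H] [InnerProductSpace ℂ H]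

/-- A strongly continuous one-parameter semigroup `(U t)_{t ≥ 0}` of bounded operators
(the values of `U` at negative times are irrelevant). -/
structure IsC0Semigroup (U : ℝ → H →L[ℂ] H) : Prop where
  map_zero : U 0 = 1
  map_add : ∀ s t, 0 ≤ s → 0 ≤ t → U (s + t) = (U s).comp (U t)
  tendsto_zero : ∀ x, Tendsto (fun t => U t x) (𝓝[>] 0) (𝓝 x)

/-- `A` is the generator of `U`, in the sign convention `U t = exp (- t A)`: the domain of `A`
is the set of those `x` for which `(x - U t x) / t` converges as `t ↓ 0`, and `A x` is the limit. -/
def IsGenerator (A : H →ₗ.[ℂ] H) (U : ℝ → H →L[ℂ] H) : Prop :=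
  ∀ x y : H, (x, y) ∈ A.graph ↔
    Tendsto (fun t : ℝ => ((t⁻¹ : ℝ) : ℂ) • (x - U t x)) (𝓝[>] 0) (𝓝 y)

/-- `A` has compact resolvent: for some `z` in the resolvent set, `(A - z)⁻¹` is compact.
The condition on `R` says that `R` is the bounded two-sided inverse of `A - z`, that is,
`R v = u` if and only if `u` is in the domain of `A` and `A u - z u = v`. -/
def HasCompactResolvent (A : H →ₗ.[ℂ] H) : Prop :=
  ∃ (z : ℂ) (R : H →L[ℂ] H),
    (∀ u v : H, R v = u ↔ (u, v + z • u) ∈ A.graph) ∧ IsCompactOperator R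

/-- The multiplicity of `μ` as an eigenvalue of `T`, that is the dimension of
`{x ∈ dom T | T x = μ x}` (zero if `μ` is not an eigenvalue). -/
def eigenMult (T : H →ₗ.[ℂ] H) (μ : ℝ) : ℕ∞ :=
  Cardinal.toENat (Module.rank ℂ
    (T.graph.comap (LinearMap.prod LinearMap.id ((μ : ℂ) • LinearMap.id)) : Submodule ℂ H))

/-- The counting function `N_T(L)`: the number of eigenvalues of `T` in `(-∞, L]`, each counted
with its multiplicity. -/
def eigenCount (T : H →ₗ.[ℂ] H) (L : ℝ) : ℝ≥0∞ :=
  ∑' μ : Set.Iic L, (eigenMult T μ : ℝ≥0∞)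

/-- `ev 0 ≤ ev 1 ≤ ev 2 ≤ ⋯` is the list of all eigenvalues of `T` in non-decreasing order,
each repeated according to its multiplicity; so `ev k` is the eigenvalue of number `k + 1`. -/
structure IsEigenvalueSequence (T : H →ₗ.[ℂ] H) (ev : ℕ → ℝ) : Prop where
  monotone : Monotone ev
  card_eq : ∀ μ : ℝ, {k : ℕ | ev k = μ}.encard = eigenMult T μ

variable [CompleteSpace H]

/-- A densely defined operator is normal if it has the same domain as its adjoint and
`‖A x‖ = ‖A* x‖` for all `x` in this domain. -/
structure IsNormalOp (A : H →ₗ.[ℂ] H) : Prop where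
  dense_domain : Dense (A.domain : Set H)
  domain_eq : A.adjoint.domain = A.domain
  norm_eq : ∀ x y z : H, (x, y) ∈ A.graph → (x, z) ∈ A.adjoint.graph → ‖y‖ = ‖z‖

/-- The real part of `A`: the closure of `(A + A*) / 2`. -/
def realPartOp (A : H →ₗ.[ℂ] H) : H →ₗ.[ℂ] H :=
  ((1 / 2 : ℂ) • (A + A.adjoint)).closure

open Classical in
/-- The trace norm, with values in `[0, ∞]`. For compact `K` it is the sum of the singular values:
the square roots of the nonzero eigenvalues of `K* K`, counted with multiplicity. It is infinite
if `K` is not compact. So `K` is trace class if and only if `traceNorm K < ∞`. -/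
def traceNorm (K : H →L[ℂ] H) : ℝ≥0∞ :=
  if IsCompactOperator K then
    ∑' μ : Set.Ioi (0 : ℝ),
      (Cardinal.toENat (Module.rank ℂ
        (Module.End.eigenspace ((K.adjoint.comp K : H →L[ℂ] H) : H →ₗ[ℂ] H) ((μ : ℝ) : ℂ))) : ℝ≥0∞)
        * ENNReal.ofReal (Real.sqrt μ)
  else ⊤

/-- A Gibbs semigroup: `U t` is trace class for every `t > 0`. -/
def IsGibbs (U : ℝ → H →L[ℂ] H) : Prop := ∀ t, 0 < t → traceNorm (U t) < ⊤

/-- `F = O(g)` along the filter `l`, in the form `limsup F / g < ∞`, for `F` with values in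
`[0, ∞]` and `g` eventually positive. -/
def IsBigOENN {α : Type*} (l : Filter α) (F : α → ℝ≥0∞) (g : α → ℝ) : Prop :=
  limsup (fun x => F x / ENNReal.ofReal (g x)) l < ⊤

end GibbsKaramata

end

/-!
# Gibbs semigroups of normal operators and Karamata's theorem

The resolvent of a normal operator `A` with compact resolvent is a compact normal operator, so
`A` has an orthonormal basis of eigenvectors `b i`, with eigenvalues `z i`
(`IsNormalOp.exists_hilbertBasis`). The semigroup acts on `b i` by `exp (-t * z i)`
(`IsC0Semigroup.apply_eigenvector`), and the real part of `A` is the maximal multiplication operator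
by `a i = re (z i)` (`IsNormalOp.mem_graph_realPartOp_iff`). Hence the trace norm of `exp (-t * A)`
is `heatSum a t = ∑ exp (-t * a i)`, also where both sides are infinite, and the counting function
of the real part is `count a L = #{i | a i ≤ L}` (`exists_spectral_data`). The `a i` are bounded
below because the semigroup is bounded at `t = 1`. What remains is a statement on a countable
family of real numbers bounded below, in which `f` is a regularly varying function of index `p`.

With `L = 1 / t`, the exponential sum agrees up to a factor `exp (ω * t)`, which tends to `1`, with
the Laplace integral of `exp (-u) * count a (u * L)` over `u > 0`; negative members of the family
cause no other trouble. Since `count a (u * L) / f L` is the product of `count a (u * L) / f (u * L)`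
and `f (u * L) / f L`, and the latter tends to `u ^ p`, Fatou's lemma gives the lower Abelian bound
(`RegVar.le_liminf_heatSum`) and dominated convergence the Abelian limit (`RegVar.tendsto_heatSum`).
The majorant comes from monotonicity of `count a` and iteration of `f (2 * L) ≤ C * f L`
(`RegVar.exists_count_le`), so that no uniform convergence theorem for regularly varying functions
is needed.

In the opposite direction, `O`-bounds follow from `count a L ≤ e * heatSum a (1 / L)`
(`count_le_heatSum`), positive lower limits by cutting off the levels beyond a large multiple of `L`
(`RegVar.liminf_count_pos`), and limits by Karamata's method (`RegVar.tendsto_count`): the limits of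
`heatSum a ((n + 1) / L) / f L` determine the limits of all sums of polynomials in `exp (-a i / L)`,
and polynomials approximate the step function that defines `count a L`
(`exists_polynomial_step`).

The gauge functions built from iterated logarithms are regularly varying because the logarithm of a
function of regular growth is slowly varying (`tendsto_log_div_log`). The condition along the
Lambert function is the substitution `L = x * exp x` (`isBigOENN_lambertW₀_iff`), and the condition
on the ordered eigenvalues is the inversion of `count a`
(`isBigOENN_eigenCount_iff_exists_isEigenvalueSequence`).
-/

namespace GibbsKaramata

/-! ### Compact normal operators -/

section Compact

open Module End ContinuousLinearMap

variable {H : Type*} [NormedAddCommGroup H] [InnerProductSpace ℂ H] [CompleteSpace H]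

local notation "⟪" x ", " y "⟫" => inner ℂ x y

theorem adjoint_apply_of_isStarNormal {R : H →L[ℂ] H} (hR : IsStarNormal R) {μ : ℂ} {v : H}
    (hv : R v = μ • v) : adjoint R v = (starRingEnd ℂ μ) • v := by
  have h1 : IsStarNormal (R - μ • (1 : H →L[ℂ] H)) := by
    have : R - μ • (1 : H →L[ℂ] H) = R - algebraMap ℂ _ μ := by
      rw [Algebra.algebraMap_eq_smul_one]
    rw [this]
    constructor
    simp only [star_sub, ← algebraMap_star_comm]
    exact ((hR.star_comm_self.sub_left (Algebra.commute_algebraMap_left _ _))).sub_right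
      (Algebra.commute_algebraMap_right _ _)
  have h2 := (ContinuousLinearMap.isStarNormal_iff_norm_eq_adjoint.mp h1) v
  have h3 : (R - μ • (1 : H →L[ℂ] H)) v = 0 := by simp [hv]
  rw [h3, norm_zero] at h2
  have h4 := norm_eq_zero.mp h2.symm
  rw [← ContinuousLinearMap.star_eq_adjoint, star_sub, star_smul, star_one] at h4
  simp only [_root_.sub_apply, _root_.smul_apply,
    one_apply_eq_self, sub_eq_zero, ContinuousLinearMap.star_eq_adjoint] at h4
  simpa using h4

theorem orthogonalFamily_eigenspace_of_isStarNormal {R : H →L[ℂ] H} (hR : IsStarNormal R) :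
    OrthogonalFamily ℂ (fun μ : ℂ => eigenspace (R : End ℂ H) μ)
      fun μ => (eigenspace (R : End ℂ H) μ).subtypeₗᵢ := by
  rintro μ ν hμν ⟨v, hv⟩ ⟨w, hw⟩
  rw [mem_eigenspace_iff] at hv hw
  rw [ContinuousLinearMap.coe_coe] at hv hw
  change ⟪v, w⟫ = 0
  have h1 : ⟪v, R w⟫ = ⟪adjoint R v, w⟫ := (ContinuousLinearMap.adjoint_inner_left R w v).symm
  rw [hw, adjoint_apply_of_isStarNormal hR hv, inner_smul_left, inner_smul_right] at h1
  simp only [RingHomCompTriple.comp_apply, RingHom.id_apply] at h1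
  have h2 : (ν - μ) * ⟪v, w⟫ = 0 := by rw [sub_mul, h1, sub_self]
  rcases mul_eq_zero.mp h2 with h | h
  · exact absurd (sub_eq_zero.mp h).symm hμν
  · exact h

/-- The spectral theorem for compact normal operators. The orthogonal complement of all eigenvectors
of `R` is invariant under `R` and `R†`; a nonzero eigenspace of `R† R` in it would be finite
dimensional and invariant under `R`, and so would contain an eigenvector of `R`. -/
theorem orthogonal_iSup_eigenspace_of_isStarNormal {R : H →L[ℂ] H} (hR : IsStarNormal R)
    (hc : IsCompactOperator R) : (⨆ μ, eigenspace (R : End ℂ H) μ)ᗮ = ⊥ := by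
  set V : Submodule ℂ H := ⨆ μ, eigenspace (R : End ℂ H) μ with hV
  have hmem : ∀ x : H, x ∈ Vᗮ ↔ ∀ (μ : ℂ) (v : H), R v = μ • v → ⟪v, x⟫ = 0 := by
    intro x
    rw [hV, ← Submodule.iInf_orthogonal]
    simp only [Submodule.mem_iInf, Submodule.mem_orthogonal, mem_eigenspace_iff,
      ContinuousLinearMap.coe_coe]
  have hRinv : ∀ x ∈ Vᗮ, R x ∈ Vᗮ := by
    intro x hx
    rw [hmem] at hx ⊢
    intro μ v hv
    rw [← ContinuousLinearMap.adjoint_inner_left, adjoint_apply_of_isStarNormal hR hv,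
      inner_smul_left, hx μ v hv, mul_zero]
  have hAinv : ∀ x ∈ Vᗮ, adjoint R x ∈ Vᗮ := by
    intro x hx
    rw [hmem] at hx ⊢
    intro μ v hv
    rw [ContinuousLinearMap.adjoint_inner_right, hv, inner_smul_left, hx μ v hv, mul_zero]
  have hSinv : ∀ x ∈ Vᗮ, (adjoint R ∘L R) x ∈ Vᗮ := fun x hx => hAinv _ (hRinv x hx)
  let S : Vᗮ →L[ℂ] Vᗮ := (adjoint R ∘L R).restrict hSinv
  have hSc : IsCompactOperator S := by
    have : IsCompactOperator (adjoint R ∘L R : H →L[ℂ] H) := hc.clm_comp (adjoint R)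
    exact IsCompactOperator.restrict' (f := ((adjoint R ∘L R : H →L[ℂ] H) : H →ₗ[ℂ] H)) this hSinv
  have hsymm : ((adjoint R ∘L R : H →L[ℂ] H) : H →ₗ[ℂ] H).IsSymmetric := by
    intro x y
    simp [ContinuousLinearMap.adjoint_inner_left, ContinuousLinearMap.adjoint_inner_right]
  have hSs : S.IsSymmetric := hsymm.restrict_invariant hSinv
  have hnone : ∀ μ, HasEigenvalue (S : End ℂ Vᗮ) μ → μ = 0 := by
    intro μ hμ
    by_contra hμ0
    have hfin := ContinuousLinearMap.finite_dimensional_eigenspace hSc μ hμ0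
    have hnt : Nontrivial (eigenspace (S : End ℂ Vᗮ) μ) :=
      Submodule.nontrivial_iff_ne_bot.mpr hμ
    let R' : Vᗮ →ₗ[ℂ] Vᗮ := (R : H →ₗ[ℂ] H).restrict hRinv
    have hcomm : ∀ y : Vᗮ, S (R' y) = R' (S y) := by
      intro y
      apply Subtype.ext
      have h1 : (adjoint R * R) = R * adjoint R := hR.star_comm_self
      have h2 := congrArg (fun T : H →L[ℂ] H => T (R y)) h1
      simpa [S, R'] using h2
    have hE : ∀ y ∈ eigenspace (S : End ℂ Vᗮ) μ, R' y ∈ eigenspace (S : End ℂ Vᗮ) μ := by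
      intro y hy
      rw [mem_eigenspace_iff] at hy ⊢
      have hy' : S y = μ • y := hy
      change S (R' y) = μ • R' y
      rw [hcomm, hy', map_smul]
    obtain ⟨ρ, hρ⟩ := Module.End.exists_eigenvalue (R'.restrict hE)
    obtain ⟨y, hy⟩ := hρ.exists_hasEigenvector
    have hy1 : R ((y : Vᗮ) : H) = ρ • ((y : Vᗮ) : H) := by
      have := congrArg (fun w : eigenspace (S : End ℂ Vᗮ) μ => ((w : Vᗮ) : H)) hy.apply_eq_smul
      simpa [R'] using this
    have h3 := (hmem _).mp (y : Vᗮ).2 ρ _ hy1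
    rw [inner_self_eq_zero] at h3
    exact hy.2 (Subtype.ext (Subtype.ext h3))
  rw [ContinuousLinearMap.eq_zero_of_forall_hasEigenvalue_eq_zero hSc hSs] at hnone
  rw [Submodule.eq_bot_iff]
  intro x hx
  have h0 : adjoint R (R x) = 0 := by
    have := congrArg (fun T : Vᗮ →L[ℂ] Vᗮ => ((T ⟨x, hx⟩ : Vᗮ) : H)) hnone
    simpa [S] using this
  have h1 : R x = 0 := by
    rw [← inner_self_eq_zero (𝕜 := ℂ), ← ContinuousLinearMap.adjoint_inner_left, h0, inner_zero_left]
  have := (hmem x).mp hx 0 x (by simp [h1])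
  rwa [inner_self_eq_zero] at this

end Compact

/-! ### Counting functions and exponential sums -/

/-- The counting function of a family `a` of real numbers: the number of indices `i` with
`a i ≤ L`. -/
noncomputable def count {ι : Type*} (a : ι → ℝ) (L : ℝ) : ℝ≥0∞ := ({i | a i ≤ L} : Set ι).encard

/-- The exponential sum `∑ exp (-t * a i)` of a family `a` of real numbers, with values in
`[0, ∞]`: the Laplace transform of its counting function. -/
noncomputable def heatSum {ι : Type*} (a : ι → ℝ) (t : ℝ) : ℝ≥0∞ :=
  ∑' i, ENNReal.ofReal (Real.exp (-t * a i))

/-! ### Normal operators with compact resolvent -/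

section Diagonal

open Module End ContinuousLinearMap

variable {H : Type*} [NormedAddCommGroup H] [InnerProductSpace ℂ H]

local notation "⟪" x ", " y "⟫" => inner ℂ x y

/-- The vectors whose coordinates vanish outside `S` form a subspace of algebraic dimension `#S`,
read in `ℕ∞`. -/
theorem toENat_rank_of_mem_iff {ι : Type*} (b : HilbertBasis ι ℂ H) (S : Set ι)
    (K : Submodule ℂ H) (hK : ∀ x, x ∈ K ↔ ∀ i, i ∉ S → ⟪b i, x⟫ = 0) :
    Cardinal.toENat (Module.rank ℂ K) = S.encard := by
  have hli : LinearIndependent ℂ (b : ι → H) := b.orthonormal.linearIndependent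
  have hspan : Submodule.span ℂ (b '' S) ≤ K := by
    rw [Submodule.span_le]
    rintro _ ⟨j, hj, rfl⟩
    rw [SetLike.mem_coe, hK]
    intro i hi
    exact b.orthonormal.2 (fun h => hi (h ▸ hj))
  have hS : Cardinal.toENat (Module.rank ℂ (Submodule.span ℂ (b '' S))) = S.encard :=
    toENat_rank_span_set (hli.linearIndepOn S)
  apply le_antisymm
  · rcases S.finite_or_infinite with hfin | hinf
    · rw [← hS]
      refine OrderHomClass.mono Cardinal.toENat (Submodule.rank_mono ?_)
      intro x hx
      have h1 := b.hasSum_repr x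
      have h2 : ∀ i ∉ hfin.toFinset, b.repr x i • b i = 0 := by
        intro i hi
        rw [Set.Finite.mem_toFinset] at hi
        rw [b.repr_apply_apply, (hK x).mp hx i hi, zero_smul]
      rw [h1.unique (hasSum_sum_of_ne_finset_zero h2)]
      refine Submodule.sum_mem _ fun i hi => Submodule.smul_mem _ _ (Submodule.subset_span ?_)
      exact ⟨i, hfin.mem_toFinset.mp hi, rfl⟩
    · rw [hinf.encard_eq]; exact le_top
  · rw [← hS]
    exact OrderHomClass.mono Cardinal.toENat (Submodule.rank_mono hspan)

/-- A sum over values weighted by multiplicities is a sum over the family itself. -/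
theorem tsum_encard_fiber_mul {ι : Type*} (a : ι → ℝ) (s : Set ℝ) (c : ℝ → ℝ≥0∞) :
    ∑' μ : s, (({i | a i = μ} : Set ι).encard : ℝ≥0∞) * c μ
      = ∑' i, s.indicator c (a i) := by
  classical
  have h1 : ∀ μ : s, (({i | a i = μ} : Set ι).encard : ℝ≥0∞) * c μ
      = ∑' i, if a i = μ then c μ else 0 := by
    intro μ
    rw [← ENNReal.tsum_set_one, ← ENNReal.tsum_mul_right, tsum_subtype {i | a i = (μ : ℝ)}
      (fun _ => 1 * c μ)]
    refine tsum_congr fun i => ?_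
    simp [Set.indicator_apply]
  rw [tsum_congr h1, ENNReal.tsum_comm]
  refine tsum_congr fun i => ?_
  by_cases hi : a i ∈ s
  · rw [tsum_eq_single ⟨a i, hi⟩]
    · simp [hi]
    · rintro ⟨μ, hμ⟩ hne
      rw [if_neg]
      rintro rfl
      exact hne rfl
  · rw [Set.indicator_of_notMem hi, ENNReal.tsum_eq_zero]
    rintro ⟨μ, hμ⟩
    rw [if_neg]
    rintro rfl
    exact hi hμ

variable [CompleteSpace H]

/-- The graph of the adjoint in terms of the graph of the operator. -/
theorem mem_graph_adjoint_iff {A : H →ₗ.[ℂ] H} (hA : Dense (A.domain : Set H)) (y w : H) :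
    (y, w) ∈ A.adjoint.graph ↔ ∀ x u, (x, u) ∈ A.graph → ⟪w, x⟫ = ⟪y, u⟫ := by
  constructor
  · intro h x u hx
    obtain ⟨y', rfl, rfl⟩ := (LinearPMap.mem_graph_iff _).mp h
    obtain ⟨x', rfl, rfl⟩ := (LinearPMap.mem_graph_iff _).mp hx
    exact (LinearPMap.adjoint_isFormalAdjoint hA y' x')
  · intro h
    have h' : ∀ x : A.domain, ⟪w, (x : H)⟫ = ⟪y, A x⟫ := fun x => h _ _ (A.mem_graph x)
    have hy := LinearPMap.mem_adjoint_domain_of_exists (T := A) y ⟨w, h'⟩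
    refine (LinearPMap.mem_graph_iff _).mpr ⟨⟨y, hy⟩, rfl, ?_⟩
    exact LinearPMap.adjoint_apply_eq hA _ h'

theorem IsNormalOp.exists_adjoint {A : H →ₗ.[ℂ] H} (hA : IsNormalOp A) {x y : H}
    (h : (x, y) ∈ A.graph) : ∃ w, (x, w) ∈ A.adjoint.graph := by
  have hx : x ∈ A.adjoint.domain := by
    rw [hA.domain_eq]; exact LinearPMap.mem_domain_of_mem_graph h
  exact ⟨_, A.adjoint.mem_graph ⟨x, hx⟩⟩

theorem IsNormalOp.exists_of_adjoint {A : H →ₗ.[ℂ] H} (hA : IsNormalOp A) {x w : H}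
    (h : (x, w) ∈ A.adjoint.graph) : ∃ y, (x, y) ∈ A.graph := by
  have hx : x ∈ A.domain := by
    rw [← hA.domain_eq]; exact LinearPMap.mem_domain_of_mem_graph h
  exact ⟨_, A.mem_graph ⟨x, hx⟩⟩

/-- Normality is invariant under a shift of the operator by a scalar. -/
theorem IsNormalOp.norm_sub_eq {A : H →ₗ.[ℂ] H} (hA : IsNormalOp A) (z : ℂ) {x y w : H}
    (h : (x, y) ∈ A.graph) (h' : (x, w) ∈ A.adjoint.graph) :
    ‖w - (starRingEnd ℂ z) • x‖ = ‖y - z • x‖ := by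
  have h1 := (mem_graph_adjoint_iff hA.dense_domain x w).mp h' x y h
  have h2 := hA.norm_eq x y w h h'
  have h3 : RCLike.re ⟪w, (starRingEnd ℂ z) • x⟫ = RCLike.re ⟪y, z • x⟫ := by
    have h4 : z * ⟪y, x⟫ = (starRingEnd ℂ) ((starRingEnd ℂ) z * ⟪x, y⟫) := by
      rw [map_mul, Complex.conj_conj, inner_conj_symm]
    rw [inner_smul_right, inner_smul_right, h1, h4]
    exact (RCLike.conj_re _).symm
  rw [← sq_eq_sq₀ (norm_nonneg _) (norm_nonneg _), norm_sub_sq (𝕜 := ℂ), norm_sub_sq (𝕜 := ℂ), h3,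
    h2, norm_smul, norm_smul, RCLike.norm_conj]

theorem IsNormalOp.mem_graph_adjoint_of_eigenvector {A : H →ₗ.[ℂ] H} (hA : IsNormalOp A) {z : ℂ}
    {x : H} (h : (x, z • x) ∈ A.graph) : (x, (starRingEnd ℂ z) • x) ∈ A.adjoint.graph := by
  obtain ⟨w, hw⟩ := hA.exists_adjoint h
  have h1 := hA.norm_sub_eq z h hw
  rw [sub_self, norm_zero, norm_eq_zero, sub_eq_zero] at h1
  rwa [← h1]

/-- The resolvent of a normal operator is normal. -/
theorem IsNormalOp.isStarNormal_resolvent {A : H →ₗ.[ℂ] H} (hA : IsNormalOp A) {z : ℂ}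
    {R : H →L[ℂ] H} (hR : ∀ u v : H, R v = u ↔ (u, v + z • u) ∈ A.graph) : IsStarNormal R := by
  have hRg : ∀ v, (R v, v + z • R v) ∈ A.graph := fun v => (hR _ _).mp rfl
  have hRg' : ∀ x y, (x, y) ∈ A.graph → R (y - z • x) = x := fun x y h =>
    (hR _ _).mpr (by simpa using h)
  have hadj : ∀ y w, (y, w) ∈ A.adjoint.graph → adjoint R (w - (starRingEnd ℂ z) • y) = y := by
    intro y w h
    refine ext_inner_right ℂ fun u => ?_
    rw [ContinuousLinearMap.adjoint_inner_left, inner_sub_left,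
      (mem_graph_adjoint_iff hA.dense_domain y w).mp h _ _ (hRg u), inner_smul_left,
      inner_add_right, inner_smul_right, Complex.conj_conj, add_sub_cancel_right]
  have hadj' : ∀ v, (adjoint R v, v + (starRingEnd ℂ z) • adjoint R v) ∈ A.adjoint.graph := by
    intro v
    rw [mem_graph_adjoint_iff hA.dense_domain]
    intro x y h
    have h1 := hRg' x y h
    have h2 : ⟪adjoint R v, y - z • x⟫ = ⟪v, x⟫ := by
      rw [ContinuousLinearMap.adjoint_inner_left, h1]
    rw [inner_sub_right, inner_smul_right] at h2
    rw [inner_add_left, inner_smul_left, Complex.conj_conj, ← h2, sub_add_cancel]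
  -- The ranges of `R` and `R†` agree, with norm-preserving preimages.
  have hex : ∀ u, ∃ v, ‖v‖ = ‖u‖ ∧ adjoint R v = R u := by
    intro u
    obtain ⟨w, hw⟩ := hA.exists_adjoint (hRg u)
    refine ⟨w - (starRingEnd ℂ z) • R u, ?_, hadj _ _ hw⟩
    rw [hA.norm_sub_eq z (hRg u) hw, add_sub_cancel_right]
  have hex' : ∀ v, ∃ u, ‖u‖ = ‖v‖ ∧ R u = adjoint R v := by
    intro v
    obtain ⟨y, hy⟩ := hA.exists_of_adjoint (hadj' v)
    refine ⟨y - z • adjoint R v, ?_, hRg' _ _ hy⟩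
    rw [← hA.norm_sub_eq z hy (hadj' v), add_sub_cancel_right]
  rw [ContinuousLinearMap.isStarNormal_iff_norm_eq_adjoint]
  intro w
  apply le_antisymm
  · obtain ⟨u, hu, hu'⟩ := hex' (R w)
    have h1 : ‖R w‖ ^ 2 ≤ ‖adjoint R w‖ * ‖R w‖ := by
      have h2 : ⟪R w, R w⟫ = ⟪adjoint R w, u⟫ := by
        rw [ContinuousLinearMap.adjoint_inner_left, hu', ContinuousLinearMap.adjoint_inner_right]
      have h3 : ‖⟪R w, R w⟫‖ = ‖R w‖ ^ 2 := by
        rw [inner_self_eq_norm_sq_to_K]; simp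
      rw [← h3, h2, ← hu]
      exact norm_inner_le_norm _ _
    rcases (norm_nonneg (R w)).eq_or_lt with h0 | h0
    · rw [← h0]; exact norm_nonneg _
    · nlinarith
  · obtain ⟨v, hv, hv'⟩ := hex (adjoint R w)
    have h1 : ‖adjoint R w‖ ^ 2 ≤ ‖R w‖ * ‖adjoint R w‖ := by
      have h2 : ⟪adjoint R w, adjoint R w⟫ = ⟪R w, v⟫ := by
        rw [ContinuousLinearMap.adjoint_inner_left, ← hv', ContinuousLinearMap.adjoint_inner_right]
      have h3 : ‖⟪adjoint R w, adjoint R w⟫‖ = ‖adjoint R w‖ ^ 2 := by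
        rw [inner_self_eq_norm_sq_to_K]; simp
      rw [← h3, h2, ← hv]
      exact norm_inner_le_norm _ _
    rcases (norm_nonneg (adjoint R w)).eq_or_lt with h0 | h0
    · rw [← h0]; exact norm_nonneg _
    · nlinarith

/-- A normal operator with compact resolvent has an orthonormal basis of eigenvectors. The
eigenvalue `ρ ≠ 0` of the resolvent at `z` corresponds to the eigenvalue `ρ⁻¹ + z`. -/
theorem IsNormalOp.exists_hilbertBasis {A : H →ₗ.[ℂ] H} (hA : IsNormalOp A)
    (hres : HasCompactResolvent A) :
    ∃ (ι : Type) (b : HilbertBasis ι ℂ H) (z : ι → ℂ), ∀ i, (b i, z i • b i) ∈ A.graph := by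
  obtain ⟨z, R, hR, hc⟩ := hres
  have hN := hA.isStarNormal_resolvent hR
  have hinj : ∀ v, R v = 0 → v = 0 := by
    intro v hv
    have := (hR 0 v).mp hv
    simpa using A.graph_fst_eq_zero_snd this rfl
  have hfd : ∀ μ : ℂ, FiniteDimensional ℂ (eigenspace (R : End ℂ H) μ) := by
    intro μ
    by_cases hμ : μ = 0
    · have : eigenspace (R : End ℂ H) μ = ⊥ := by
        rw [Submodule.eq_bot_iff]
        intro x hx
        rw [mem_eigenspace_iff, hμ, zero_smul] at hx
        exact hinj x hx
      rw [this]; infer_instance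
    · exact ContinuousLinearMap.finite_dimensional_eigenspace hc μ hμ
  let e : ∀ μ : ℂ, OrthonormalBasis _ ℂ (eigenspace (R : End ℂ H) μ) := fun μ =>
    stdOrthonormalBasis ℂ _
  have ho : Orthonormal ℂ (fun i : (Σ μ : ℂ, Fin (finrank ℂ (eigenspace (R : End ℂ H) μ))) =>
      ((e i.1 i.2 : _) : H)) := (orthogonalFamily_eigenspace_of_isStarNormal hN).orthonormal_sigma_orthonormal
    (v_family := fun μ => e μ) (fun μ => (e μ).orthonormal)
  have hle : (⨆ μ, eigenspace (R : End ℂ H) μ) ≤ Submodule.span ℂ (Set.range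
      (fun i : (Σ μ : ℂ, Fin (finrank ℂ (eigenspace (R : End ℂ H) μ))) => ((e i.1 i.2 : _) : H))) := by
    refine iSup_le fun μ x hx => ?_
    have h1 := (e μ).sum_repr ⟨x, hx⟩
    have h2 := congrArg (fun w : eigenspace (R : End ℂ H) μ => (w : H)) h1
    simp only [AddSubmonoidClass.coe_finsetSum, Submodule.coe_smul] at h2
    rw [← h2]
    exact Submodule.sum_mem _ fun i _ => Submodule.smul_mem _ _
      (Submodule.subset_span ⟨⟨μ, i⟩, rfl⟩)
  have hbot : (Submodule.span ℂ (Set.range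
      (fun i : (Σ μ : ℂ, Fin (finrank ℂ (eigenspace (R : End ℂ H) μ))) => ((e i.1 i.2 : _) : H))))ᗮ = ⊥ := by
    rw [← le_bot_iff, ← orthogonal_iSup_eigenspace_of_isStarNormal hN hc]
    exact Submodule.orthogonal_le hle
  refine ⟨_, HilbertBasis.mkOfOrthogonalEqBot ho hbot, fun i => i.1⁻¹ + z, ?_⟩
  intro i
  rw [HilbertBasis.coe_mkOfOrthogonalEqBot]
  have h1 : R (e i.1 i.2 : H) = i.1 • (e i.1 i.2 : H) := mem_eigenspace_iff.mp (e i.1 i.2).2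
  have h0 : i.1 ≠ 0 := by
    intro h0
    have h2 := hinj _ (h1.trans (by
      have h3 : i.1 • (e i.1 i.2 : H) = (0 : ℂ) • (e i.1 i.2 : H) := congrArg (· • _) h0
      rw [h3, zero_smul]))
    exact (e i.1).orthonormal.ne_zero i.2 (Subtype.ext h2)
  have h2 : R (i.1⁻¹ • (e i.1 i.2 : H)) = (e i.1 i.2 : H) := by
    rw [map_smul, h1, smul_smul, inv_mul_cancel₀ h0, one_smul]
  have h3 := (hR _ _).mp h2
  rwa [← add_smul] at h3

end Diagonal

/-! ### Semigroups and trace norms of diagonal operators -/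

section Semigroup

open Module End ContinuousLinearMap

variable {H : Type*} [NormedAddCommGroup H] [InnerProductSpace ℂ H] {U : ℝ → H →L[ℂ] H}

local notation "⟪" x ", " y "⟫" => inner ℂ x y

theorem IsC0Semigroup.tendsto_nhdsGE_zero (hU : IsC0Semigroup U) (x : H) :
    Tendsto (fun t => U t x) (𝓝[≥] 0) (𝓝 x) := by
  have h : ContinuousWithinAt (fun t => U t x) (Set.Ioi 0) 0 := by
    change Tendsto _ _ (𝓝 (U 0 x))
    rw [hU.map_zero]
    exact hU.tendsto_zero x
  have h2 := continuousWithinAt_Ioi_iff_Ici.mp h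
  change Tendsto _ _ (𝓝 (U 0 x)) at h2
  rwa [hU.map_zero] at h2

/-- A strongly continuous semigroup is bounded in norm near `0`, by the uniform boundedness
principle. -/
theorem IsC0Semigroup.exists_norm_le [CompleteSpace H] (hU : IsC0Semigroup U) :
    ∃ δ > 0, ∃ M, ∀ s, 0 ≤ s → s ≤ δ → ‖U s‖ ≤ M := by
  by_contra! hcon
  have h1 : ∀ n : ℕ, ∃ s, 0 ≤ s ∧ s ≤ 1 / ((n : ℝ) + 1) ∧ (n : ℝ) < ‖U s‖ := fun n =>
    hcon _ Nat.one_div_pos_of_nat n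
  choose s hs0 hs1 hs2 using h1
  have hs : Tendsto s atTop (𝓝[≥] 0) :=
    tendsto_nhdsWithin_iff.mpr ⟨squeeze_zero hs0 hs1 tendsto_one_div_add_atTop_nhds_zero_nat,
      Eventually.of_forall hs0⟩
  obtain ⟨C, hC⟩ := banach_steinhaus (g := fun n => U (s n)) (by
    intro x
    obtain ⟨C, hC⟩ := (((hU.tendsto_nhdsGE_zero x).comp hs).norm).bddAbove_range
    exact ⟨C, fun n => hC ⟨n, rfl⟩⟩)
  obtain ⟨n, hn⟩ := exists_nat_gt C
  exact absurd ((hs2 n).trans_le (hC n)) (not_lt.mpr hn.le)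

theorem IsC0Semigroup.continuousOn_Icc (hU : IsC0Semigroup U) {δ M : ℝ}
    (hM : ∀ s, 0 ≤ s → s ≤ δ → ‖U s‖ ≤ M) (x : H) :
    ContinuousOn (fun t => U t x) (Set.Icc 0 δ) := by
  have key : ∀ s t, 0 ≤ s → s ≤ t → t ≤ δ → ‖U t x - U s x‖ ≤ M * ‖U (t - s) x - x‖ := by
    intro s t hs hst ht
    have h1 : U t x = U s (U (t - s) x) := by
      have := hU.map_add s (t - s) hs (sub_nonneg.mpr hst)
      rw [add_sub_cancel] at this
      rw [this]; rfl
    rw [h1, ← map_sub]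
    exact (U s).le_of_opNorm_le (hM s hs (hst.trans ht)) _
  intro t ht
  rw [ContinuousWithinAt, tendsto_iff_norm_sub_tendsto_zero]
  have h0 : Tendsto (fun s : ℝ => |s - t|) (𝓝[Set.Icc 0 δ] t) (𝓝[≥] 0) := by
    refine tendsto_nhdsWithin_iff.mpr ⟨?_, Eventually.of_forall fun s => Set.mem_Ici.mpr (abs_nonneg _)⟩
    have : Continuous fun s : ℝ => |s - t| := by fun_prop
    simpa using (this.tendsto t).mono_left nhdsWithin_le_nhds
  have h1 : Tendsto (fun s : ℝ => M * ‖U |s - t| x - x‖) (𝓝[Set.Icc 0 δ] t) (𝓝 0) := by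
    have := ((hU.tendsto_nhdsGE_zero x).comp h0)
    simpa using (tendsto_iff_norm_sub_tendsto_zero.mp this).const_mul M
  refine squeeze_zero' (Eventually.of_forall fun s => norm_nonneg _) ?_ h1
  filter_upwards [self_mem_nhdsWithin] with s hs
  rcases le_total s t with h | h
  · rw [norm_sub_rev, abs_sub_comm, abs_of_nonneg (sub_nonneg.mpr h)]
    exact key s t hs.1 h ht.2
  · rw [abs_of_nonneg (sub_nonneg.mpr h)]
    exact key t s ht.1 h hs.2

/-- The semigroup acts on an eigenvector of its generator by the exponential of the eigenvalue. -/
theorem IsC0Semigroup.apply_eigenvector [CompleteSpace H] (hU : IsC0Semigroup U)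
    {A : H →ₗ.[ℂ] H} (hA : IsGenerator A U) {z : ℂ} {e : H} (he : (e, z • e) ∈ A.graph) {t : ℝ}
    (ht : 0 ≤ t) : U t e = Complex.exp (-(t : ℂ) * z) • e := by
  obtain ⟨δ, hδ, M, hM⟩ := hU.exists_norm_le
  have h0 : HasDerivWithinAt (fun h => U h e) (-(z • e)) (Set.Ici 0) 0 := by
    rw [← hasDerivWithinAt_Ioi_iff_Ici, hasDerivWithinAt_iff_tendsto_slope' Set.self_notMem_Ioi]
    have h1 := ((hA e (z • e)).mp he).neg
    refine h1.congr fun s => ?_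
    rw [slope_def_module, hU.map_zero, sub_zero, Complex.coe_smul, ← smul_neg, neg_sub]
    rfl
  have hd : ∀ s, 0 ≤ s → HasDerivWithinAt (fun h => U h e) (-(z • U s e)) (Set.Ici s) s := by
    intro s hs
    have h1 : HasDerivWithinAt (fun h : ℝ => h - s) 1 (Set.Ici s) s :=
      (hasDerivWithinAt_id s _).sub_const s
    have h2 := HasDerivWithinAt.scomp_of_eq s h0 h1
      (fun h (hh : s ≤ h) => sub_nonneg.mpr hh) (sub_self s).symm
    have h3 := ((U s).restrictScalars ℝ).hasFDerivAt.comp_hasDerivWithinAt s h2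
    have h4 : ((U s).restrictScalars ℝ) ((1 : ℝ) • -(z • e)) = -(z • U s e) := by simp
    rw [h4] at h3
    refine h3.congr_of_mem (fun h hh => ?_) Set.self_mem_Ici
    have := hU.map_add s (h - s) hs (sub_nonneg.mpr hh)
    rw [add_sub_cancel] at this
    change U h e = U s (U (h - s) e)
    rw [this]; rfl
  have hexp : ∀ s : ℝ, HasDerivAt (fun h : ℝ => Complex.exp ((h : ℂ) * z))
      (Complex.exp ((s : ℂ) * z) * z) s := by
    intro s
    have h1 : HasDerivAt (fun h : ℝ => (h : ℂ) * z) z s := by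
      simpa using (Complex.ofRealCLM.hasDerivAt (x := s)).mul_const z
    exact h1.cexp
  have hconst := constant_of_has_deriv_right_zero (a := 0) (b := δ)
    (f := fun s : ℝ => Complex.exp ((s : ℂ) * z) • U s e)
    (ContinuousOn.smul (by fun_prop) (hU.continuousOn_Icc hM e)) (by
      intro s hs
      have h1 := (hexp s).hasDerivWithinAt (s := Set.Ici s) |>.smul (hd s hs.1)
      convert! h1 using 1
      rw [smul_neg, smul_smul, neg_add_cancel])
  have hsmall : ∀ s : ℝ, 0 ≤ s → s ≤ δ → U s e = Complex.exp (-(s : ℂ) * z) • e := by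
    intro s hs hs'
    have h1 := hconst s ⟨hs, hs'⟩
    simp only [Complex.ofReal_zero, zero_mul, Complex.exp_zero, one_smul, hU.map_zero,
      one_apply_eq_self] at h1
    have h2 : Complex.exp (-(s : ℂ) * z) • (Complex.exp ((s : ℂ) * z) • U s e) = U s e := by
      rw [smul_smul, ← Complex.exp_add]; simp
    rw [← h2, h1]
  have hmul : ∀ (s : ℝ), 0 ≤ s → s ≤ δ → ∀ n : ℕ,
      U (n * s) e = Complex.exp (-((n * s : ℝ) : ℂ) * z) • e := by
    intro s hs hs' n
    induction n with
    | zero => simp [hU.map_zero]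
    | succ n ih =>
      have h1 : ((n + 1 : ℕ) : ℝ) * s = s + n * s := by push_cast; ring
      rw [h1, hU.map_add s (n * s) hs (by positivity), ContinuousLinearMap.comp_apply, ih,
        map_smul, hsmall s hs hs', smul_smul, ← Complex.exp_add]
      congr 2
      push_cast; ring
  -- Reach an arbitrary time by `n` steps of length at most `δ`.
  obtain ⟨n, hn⟩ := exists_nat_gt (t / δ)
  have hn0 : 0 < (n : ℝ) := lt_of_le_of_lt (by positivity) hn
  have h1 := hmul (t / n) (by positivity) (by
    rw [div_lt_iff₀ hδ] at hn
    rw [div_le_iff₀ hn0]; linarith) n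
  rwa [mul_div_cancel₀ t hn0.ne'] at h1

variable {ι : Type*} {b : HilbertBasis ι ℂ H} {z : ι → ℂ}

/-- A bounded operator that acts on a basis by `exp (-z i)` bounds the real parts of `z i` from
below, since `exp (-re (z i)) ≤ ‖T‖`. -/
theorem exists_le_re_of_apply_basis {T : H →L[ℂ] H}
    (hT : ∀ i, T (b i) = Complex.exp (-z i) • b i) : ∃ ω, 0 ≤ ω ∧ ∀ i, -ω ≤ (z i).re := by
  refine ⟨‖T‖, norm_nonneg _, fun i => ?_⟩
  have h1 := T.le_opNorm (b i)
  rw [hT, norm_smul, b.orthonormal.1 i, mul_one, mul_one, Complex.norm_exp, Complex.neg_re] at h1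
  have h2 := Real.add_one_le_exp (-(z i).re)
  linarith

variable [CompleteSpace H]

/-- A diagonal operator with absolutely summable coefficients is the sum in operator norm of its
rank-one parts. -/
theorem isCompactOperator_of_summable {T : H →L[ℂ] H} {c : ι → ℂ} (hT : ∀ i, T (b i) = c i • b i)
    (hc : Summable fun i => ‖c i‖) : IsCompactOperator T := by
  let F : ι → H →L[ℂ] H := fun i => c i • (innerSL ℂ (b i)).smulRight (b i)
  have hF : Summable F := by
    refine Summable.of_norm_bounded hc fun i => ?_
    simp [F, norm_smul, b.orthonormal.1 i]
  have hFT : ∑' i, F i = T := by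
    ext x
    have h1 : HasSum (fun i => F i x) ((∑' i, F i) x) :=
      hF.hasSum.mapL (ContinuousLinearMap.apply ℂ H x)
    refine h1.unique ?_
    have h2 := (b.hasSum_repr x).mapL T
    refine h2.congr_fun fun i => ?_
    simp [F, hT, b.repr_apply_apply, smul_smul, mul_comm]
  rw [← hFT]
  refine isCompactOperator_of_tendsto hF.hasSum (Eventually.of_forall fun s => ?_)
  refine (compactOperator (RingHom.id ℂ) H H).sum_mem (t := s) (f := F) fun i _ => ?_
  refine (compactOperator (RingHom.id ℂ) H H).smul_mem _ ?_
  exact (isCompactOperator_of_locallyCompactSpace_dom (innerSL ℂ (b i))).clm_comp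
    (ContinuousLinearMap.toSpanSingleton ℂ (b i))

/-- The trace norm of an injective diagonal operator. If the operator is not compact, the sum is
infinite as well. -/
theorem traceNorm_eq_tsum {T : H →L[ℂ] H} {c : ι → ℂ} (hT : ∀ i, T (b i) = c i • b i)
    (hc : ∀ i, c i ≠ 0) : traceNorm T = ∑' i, ENNReal.ofReal ‖c i‖ := by
  unfold traceNorm
  split_ifs with hcomp
  · have hTT : ∀ x i, ⟪b i, adjoint T (T x)⟫ = ((‖c i‖ ^ 2 : ℝ) : ℂ) * ⟪b i, x⟫ := by
      intro x i
      have h1 : HasSum (fun j => ⟪b i, T (b.repr x j • b j)⟫) ⟪b i, T x⟫ :=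
        ((b.hasSum_repr x).mapL T).mapL (innerSL ℂ (b i))
      have h2 : ⟪b i, T x⟫ = ⟪b i, T (b.repr x i • b i)⟫ := by
        refine h1.unique (hasSum_single i fun j hj => ?_)
        rw [map_smul, hT, inner_smul_right, inner_smul_right, b.orthonormal.2 hj.symm, mul_zero,
          mul_zero]
      rw [ContinuousLinearMap.adjoint_inner_right, hT, inner_smul_left, h2, map_smul, hT,
        inner_smul_right, inner_smul_right, inner_self_eq_norm_sq_to_K, b.orthonormal.1 i,
        b.repr_apply_apply, mul_comm ⟪b i, x⟫]
      simp [← mul_assoc, Complex.conj_mul']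
    have hrank : ∀ μ : ℝ, Cardinal.toENat (Module.rank ℂ (Module.End.eigenspace
        ((T.adjoint.comp T : H →L[ℂ] H) : H →ₗ[ℂ] H) ((μ : ℝ) : ℂ)))
        = {i | ‖c i‖ ^ 2 = μ}.encard := by
      intro μ
      refine toENat_rank_of_mem_iff b _ _ fun x => ?_
      rw [mem_eigenspace_iff]
      constructor
      · intro hx i hi
        have h1 := hTT x i
        have hx' : adjoint T (T x) = (μ : ℂ) • x := hx
        rw [hx', inner_smul_right, ← sub_eq_zero, ← sub_mul, mul_eq_zero] at h1
        refine h1.resolve_left fun h => hi ?_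
        exact_mod_cast (sub_eq_zero.mp h).symm
      · intro h
        change adjoint T (T x) = (μ : ℂ) • x
        refine b.repr.injective (lp.ext (funext fun i => ?_))
        rw [b.repr_apply_apply, b.repr_apply_apply, hTT, inner_smul_right]
        by_cases hi : ‖c i‖ ^ 2 = μ
        · rw [hi]
        · rw [h i hi, mul_zero, mul_zero]
    simp_rw [hrank]
    rw [tsum_encard_fiber_mul (fun i => ‖c i‖ ^ 2) (Set.Ioi 0)
      (fun μ => ENNReal.ofReal (Real.sqrt μ))]
    refine tsum_congr fun i => ?_
    rw [Set.indicator_of_mem (Set.mem_Ioi.mpr (pow_pos (norm_pos_iff.mpr (hc i)) 2)),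
      Real.sqrt_sq (norm_nonneg _)]
  · by_contra hne
    apply hcomp
    refine isCompactOperator_of_summable hT ?_
    have h1 := ENNReal.summable_toReal (Ne.symm hne)
    simpa [ENNReal.toReal_ofReal] using h1

end Semigroup

/-! ### The real part of a normal operator -/

section RealPart

open Module End ContinuousLinearMap

variable {H : Type*} [NormedAddCommGroup H] [InnerProductSpace ℂ H] [CompleteSpace H]
  {ι : Type*} {b : HilbertBasis ι ℂ H} {z : ι → ℂ} {A : H →ₗ.[ℂ] H}

local notation "⟪" x ", " y "⟫" => inner ℂ x y

/-- In an orthonormal basis of eigenvectors of `A`, the real part of `A` is the maximal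
multiplication operator by the real parts of the eigenvalues. -/
theorem IsNormalOp.mem_graph_realPartOp_iff (hA : IsNormalOp A)
    (hb : ∀ i, (b i, z i • b i) ∈ A.graph) (x y : H) :
    (x, y) ∈ (realPartOp A).graph ↔ ∀ i, ⟪b i, y⟫ = ((z i).re : ℂ) * ⟪b i, x⟫ := by
  set B : H →ₗ.[ℂ] H := (1 / 2 : ℂ) • (A + A.adjoint)
  have hb' := fun i => hA.mem_graph_adjoint_of_eigenvector (hb i)
  have hBg : ∀ x y w, (x, y) ∈ A.graph → (x, w) ∈ A.adjoint.graph →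
      (x, (1 / 2 : ℂ) • (y + w)) ∈ B.graph := by
    intro x y w h h'
    obtain ⟨x1, rfl, rfl⟩ := (LinearPMap.mem_graph_iff _).mp h
    obtain ⟨x2, hx, rfl⟩ := (LinearPMap.mem_graph_iff _).mp h'
    have hx' : (x2 : H) = x1 := hx
    have hx1 : (x1 : H) ∈ A.adjoint.domain := hx' ▸ x2.2
    refine (LinearPMap.mem_graph_iff _).mpr ⟨⟨x1, x1.2, hx1⟩, rfl, ?_⟩
    obtain rfl : x2 = ⟨x1, hx1⟩ := Subtype.ext hx'
    rfl
  have hBb : ∀ i, (b i, ((z i).re : ℂ) • b i) ∈ B.graph := by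
    intro i
    have h1 := hBg _ _ _ (hb i) (hb' i)
    rw [← add_smul, smul_smul, Complex.add_conj] at h1
    convert! h1 using 3
    push_cast; ring
  have hBcoef : ∀ p : H × H, p ∈ B.graph → ∀ i, ⟪b i, p.2⟫ = ((z i).re : ℂ) * ⟪b i, p.1⟫ := by
    rintro ⟨x, y⟩ hp i
    obtain ⟨⟨x', hx1, hx2⟩, rfl, rfl⟩ := (LinearPMap.mem_graph_iff _).mp hp
    have h1 : (x', A ⟨x', hx1⟩) ∈ A.graph := A.mem_graph ⟨x', hx1⟩
    have h2 : (x', A.adjoint ⟨x', hx2⟩) ∈ A.adjoint.graph := A.adjoint.mem_graph ⟨x', hx2⟩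
    have h3 := (mem_graph_adjoint_iff hA.dense_domain _ _).mp (hb' i) _ _ h1
    have h4 := (mem_graph_adjoint_iff hA.dense_domain _ _).mp h2 _ _ (hb i)
    have h5 : ⟪b i, A.adjoint ⟨x', hx2⟩⟫ = (starRingEnd ℂ (z i)) * ⟪b i, x'⟫ := by
      rw [← inner_conj_symm, h4, inner_smul_right, map_mul, inner_conj_symm]
    rw [inner_smul_left, Complex.conj_conj] at h3
    change ⟪b i, (1 / 2 : ℂ) • (A ⟨x', hx1⟩ + A.adjoint ⟨x', hx2⟩)⟫ = _ * ⟪b i, x'⟫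
    rw [inner_smul_right, inner_add_right, h5, ← h3, ← add_mul, Complex.add_conj, ← mul_assoc]
    congr 1
    push_cast; ring
  have hcl : IsClosed {p : H × H | ∀ i, ⟪b i, p.2⟫ = ((z i).re : ℂ) * ⟪b i, p.1⟫} := by
    simp only [Set.ofPred_forall]
    refine isClosed_iInter fun i => isClosed_eq ?_ ?_ <;> fun_prop
  have hclos : ∀ p : H × H, p ∈ B.graph.topologicalClosure →
      ∀ i, ⟪b i, p.2⟫ = ((z i).re : ℂ) * ⟪b i, p.1⟫ := fun p hp =>
    closure_minimal (fun q hq => hBcoef q hq) hcl hp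
  have hclosable : B.IsClosable := by
    use B.graph.topologicalClosure.toLinearPMap
    rw [Submodule.toLinearPMap_graph_eq]
    rintro ⟨x, y⟩ hx (rfl : x = 0)
    refine b.repr.injective (lp.ext (funext fun i => ?_))
    rw [b.repr_apply_apply, hclos _ hx i]
    simp
  change (x, y) ∈ B.closure.graph ↔ _
  rw [← hclosable.graph_closure_eq_closure_graph]
  refine ⟨fun h => hclos _ h, fun h => ?_⟩
  have h1 : HasSum (fun i => (b.repr x i • b i, b.repr y i • b i)) (x, y) :=
    (b.hasSum_repr x).prodMk (b.hasSum_repr y)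
  refine mem_closure_of_tendsto h1 (Eventually.of_forall fun s => ?_)
  refine B.graph.sum_mem fun i _ => ?_
  have h2 := B.graph.smul_mem (b.repr x i) (hBb i)
  convert! h2 using 1
  rw [Prod.smul_mk, smul_smul, b.repr_apply_apply, b.repr_apply_apply, h i, mul_comm]

theorem IsNormalOp.eigenMult_realPartOp (hA : IsNormalOp A)
    (hb : ∀ i, (b i, z i • b i) ∈ A.graph) (μ : ℝ) :
    eigenMult (realPartOp A) μ = {i | (z i).re = μ}.encard := by
  unfold eigenMult
  refine toENat_rank_of_mem_iff b _ _ fun x => ?_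
  have h1 : x ∈ (realPartOp A).graph.comap
      (LinearMap.prod LinearMap.id ((μ : ℂ) • LinearMap.id)) ↔
      (x, (μ : ℂ) • x) ∈ (realPartOp A).graph := Iff.rfl
  rw [h1, hA.mem_graph_realPartOp_iff hb]
  refine forall_congr' fun i => ?_
  rw [inner_smul_right, ← sub_eq_zero, ← sub_mul, mul_eq_zero, sub_eq_zero, Complex.ofReal_inj,
    or_iff_not_imp_left, eq_comm]
  rfl

theorem tsum_encard_fiber_Iic {ι : Type*} (a : ι → ℝ) (L : ℝ) :
    ∑' μ : Set.Iic L, (({i | a i = μ} : Set ι).encard : ℝ≥0∞) = count a L := by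
  have h1 := tsum_encard_fiber_mul a (Set.Iic L) (fun _ => 1)
  simp only [mul_one] at h1
  rw [h1, count, ← ENNReal.tsum_set_one, tsum_subtype {i | a i ≤ L} (fun _ => (1 : ℝ≥0∞))]
  rfl

omit [CompleteSpace H] in
theorem countable_of_orthonormal [TopologicalSpace.SeparableSpace H] {v : ι → H}
    (hv : Orthonormal ℂ v) : Countable ι := by
  -- The balls of radius `1 / 2` around the vectors are disjoint.
  refine Pairwise.countable_of_isOpen_disjoint (s := fun i => Metric.ball (v i) (1 / 2)) ?_
    (fun i => Metric.isOpen_ball) (fun i => ⟨v i, Metric.mem_ball_self (by norm_num)⟩)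
  intro i j hij
  refine Metric.ball_disjoint_ball ?_
  have h1 : ‖v i - v j‖ ^ 2 = 2 := by
    rw [norm_sub_sq (𝕜 := ℂ), hv.2 hij, hv.1, hv.1]; norm_num
  rw [dist_eq_norm]
  nlinarith [norm_nonneg (v i - v j)]

/-- The spectral data of the problem: counting function and trace norm depend only on the family
`a` of real parts of the eigenvalues. -/
theorem exists_spectral_data [TopologicalSpace.SeparableSpace H] (hH : ¬ FiniteDimensional ℂ H)
    {A : H →ₗ.[ℂ] H} {U : ℝ → H →L[ℂ] H} (hU : IsC0Semigroup U) (hgen : IsGenerator A U)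
    (hA : IsNormalOp A) (hres : HasCompactResolvent A) :
    ∃ (ι : Type) (a : ι → ℝ) (ω : ℝ), Countable ι ∧ Infinite ι ∧ 0 ≤ ω ∧ (∀ i, -ω ≤ a i) ∧
      (∀ t, 0 ≤ t → traceNorm (U t) = heatSum a t) ∧
      (∀ μ, eigenMult (realPartOp A) μ = ({i | a i = μ} : Set ι).encard) ∧
      (realPartOp A = 0 → ∀ i, a i = 0) := by
  obtain ⟨ι, b, z, hb⟩ := hA.exists_hilbertBasis hres
  have hUb : ∀ t : ℝ, 0 ≤ t → ∀ i, U t (b i) = Complex.exp (-(t : ℂ) * z i) • b i :=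
    fun t ht i => hU.apply_eigenvector hgen (hb i) ht
  obtain ⟨ω, hω, hωz⟩ := exists_le_re_of_apply_basis (b := b) (z := z) (T := U 1) (fun i => by
    rw [hUb 1 zero_le_one i]; simp)
  refine ⟨ι, fun i => (z i).re, ω, countable_of_orthonormal b.orthonormal, ?_, hω, hωz, ?_, hA.eigenMult_realPartOp hb, ?_⟩
  · by_contra hι
    have : Finite ι := not_infinite_iff_finite.mp hι
    have : Fintype ι := Fintype.ofFinite ι
    exact hH (Module.Basis.finiteDimensional_of_finite b.toOrthonormalBasis.toBasis)
  · intro t ht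
    rw [traceNorm_eq_tsum (hUb t ht) (fun i => Complex.exp_ne_zero _), heatSum]
    refine tsum_congr fun i => ?_
    rw [Complex.norm_exp]
    simp
  · intro h0 i
    have h1 : (b i, (0 : H)) ∈ (realPartOp A).graph := by
      rw [h0]
      exact (LinearPMap.mem_graph_iff _).mpr ⟨⟨b i, trivial⟩, rfl, rfl⟩
    have h2 := (hA.mem_graph_realPartOp_iff hb _ _).mp h1 i
    rw [inner_zero_right, inner_self_eq_norm_sq_to_K, b.orthonormal.1 i] at h2
    simpa using h2.symm

end RealPart

/-! ### Abelian theorems for counting functions -/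

section Laplace

open MeasureTheory Set

variable {ι : Type*} {a : ι → ℝ}

theorem count_mono : Monotone (count a) := by
  intro L M h
  exact ENat.toENNReal_le.mpr (encard_le_encard fun i (hi : a i ≤ L) => le_trans hi h)

theorem measurable_count : Measurable (count a) := count_mono.measurable

theorem count_eq_tsum (L : ℝ) : count a L = ∑' i, if a i ≤ L then (1 : ℝ≥0∞) else 0 := by
  rw [count, ← ENNReal.tsum_set_one, tsum_subtype {i | a i ≤ L} (fun _ => (1 : ℝ≥0∞))]
  refine tsum_congr fun i => ?_
  simp [indicator_apply]

/-- The Laplace transform of the counting function; only levels in `(0, ∞)` enter, so that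
negative members of the family count as if they were zero. -/
noncomputable def laplaceCount (a : ι → ℝ) (L : ℝ) : ℝ≥0∞ :=
  ∫⁻ u in Ioi 0, ENNReal.ofReal (Real.exp (-u)) * count a (u * L)

theorem laplaceCount_eq_tsum [Countable ι] {L : ℝ} (hL : 0 < L) :
    laplaceCount a L = ∑' i, ENNReal.ofReal (Real.exp (-max (a i / L) 0)) := by
  unfold laplaceCount
  simp_rw [count_eq_tsum, ← ENNReal.tsum_mul_left]
  rw [lintegral_tsum]
  · refine tsum_congr fun i => ?_
    have h1 : ∀ u : ℝ, ENNReal.ofReal (Real.exp (-u)) * (if a i ≤ u * L then (1 : ℝ≥0∞) else 0)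
        = (Ici (a i / L)).indicator (fun u => ENNReal.ofReal (Real.exp (-u))) u := by
      intro u
      simp only [indicator_apply, mem_Ici, div_le_iff₀ hL]
      split_ifs <;> simp
    simp_rw [h1]
    rw [setLIntegral_indicator measurableSet_Ici]
    have h2 : (Ici (a i / L) ∩ Ioi 0 : Set ℝ) =ᵐ[volume] Ioi (max (a i / L) 0) := by
      rw [← Ioi_inter_Ioi]
      exact Ioi_ae_eq_Ici.symm.inter (ae_eq_refl _)
    rw [setLIntegral_congr h2, ← integral_exp_neg_Ioi,
      ofReal_integral_eq_lintegral_ofReal (integrableOn_exp_neg_Ioi _)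
        (ae_of_all _ fun u => (Real.exp_pos _).le)]
  · intro i
    refine (Measurable.mul (by fun_prop) (Measurable.ite ?_ measurable_const measurable_const)).aemeasurable
    exact measurableSet_le measurable_const (by fun_prop)

theorem laplaceCount_le_heatSum [Countable ι] {L : ℝ} (hL : 0 < L) :
    laplaceCount a L ≤ heatSum a L⁻¹ := by
  rw [laplaceCount_eq_tsum hL]
  refine ENNReal.tsum_le_tsum fun i => ENNReal.ofReal_le_ofReal (Real.exp_le_exp.mpr ?_)
  have := le_max_left (a i / L) 0
  rw [div_eq_inv_mul] at this ⊢
  linarith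

theorem heatSum_le_laplaceCount [Countable ι] {ω : ℝ} (hω : 0 ≤ ω) (ha : ∀ i, -ω ≤ a i) {L : ℝ}
    (hL : 0 < L) : heatSum a L⁻¹ ≤ ENNReal.ofReal (Real.exp (ω / L)) * laplaceCount a L := by
  rw [laplaceCount_eq_tsum hL, ← ENNReal.tsum_mul_left]
  refine ENNReal.tsum_le_tsum fun i => ?_
  rw [← ENNReal.ofReal_mul (Real.exp_pos _).le, ← Real.exp_add]
  refine ENNReal.ofReal_le_ofReal (Real.exp_le_exp.mpr ?_)
  have h1 : 0 ≤ ω / L := by positivity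
  have h2 : -(ω / L) ≤ a i / L := by
    rw [← neg_div]; exact div_le_div_of_nonneg_right (ha i) hL.le
  rw [neg_mul, ← div_eq_inv_mul]
  rcases le_total (a i / L) 0 with h | h
  · rw [max_eq_right h]; linarith
  · rw [max_eq_left h]; linarith

theorem count_le_heatSum (M : ℝ) {L : ℝ} (hL : 0 < L) :
    count a (M * L) ≤ ENNReal.ofReal (Real.exp M) * heatSum a L⁻¹ := by
  rw [count_eq_tsum, heatSum, ← ENNReal.tsum_mul_left]
  refine ENNReal.tsum_le_tsum fun i => ?_
  split_ifs with h
  · rw [← ENNReal.ofReal_mul (Real.exp_pos _).le, ← Real.exp_add, ENNReal.one_le_ofReal,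
      Real.one_le_exp_iff, neg_mul, ← div_eq_inv_mul]
    have := (div_le_iff₀ hL).mpr h
    linarith
  · exact zero_le

/-- Splitting the exponential sum at the level `M * L`: beyond that level half of the exponent is
used for the factor `exp (-M / 2)`. -/
theorem heatSum_le_add {ω : ℝ} (ha : ∀ i, -ω ≤ a i) (M : ℝ) {L : ℝ} (hL : 0 < L) :
    heatSum a L⁻¹ ≤ ENNReal.ofReal (Real.exp (ω / L)) * count a (M * L)
      + ENNReal.ofReal (Real.exp (-M / 2)) * heatSum a (2 * L)⁻¹ := by
  rw [count_eq_tsum, heatSum, heatSum, ← ENNReal.tsum_mul_left, ← ENNReal.tsum_mul_left,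
    ← ENNReal.tsum_add]
  refine ENNReal.tsum_le_tsum fun i => ?_
  split_ifs with h
  · refine le_add_of_le_of_nonneg ?_ zero_le
    rw [mul_one]
    refine ENNReal.ofReal_le_ofReal (Real.exp_le_exp.mpr ?_)
    have h2 : -(ω / L) ≤ a i / L := by
      rw [← neg_div]; exact div_le_div_of_nonneg_right (ha i) hL.le
    rw [neg_mul, ← div_eq_inv_mul]
    linarith
  · rw [mul_zero, zero_add, ← ENNReal.ofReal_mul (Real.exp_pos _).le, ← Real.exp_add]
    refine ENNReal.ofReal_le_ofReal (Real.exp_le_exp.mpr ?_)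
    have h1 : M ≤ a i / L := (le_div_iff₀ hL).mpr (not_le.mp h).le
    have h3 : (2 * L)⁻¹ * a i = a i / L / 2 := by field_simp
    rw [neg_mul, neg_mul, ← div_eq_inv_mul, h3]
    linarith

theorem heatSum_lt_top_of_le {ω : ℝ} (ha : ∀ i, -ω ≤ a i) {s t : ℝ} (hst : s ≤ t)
    (hs : heatSum a s < ⊤) : heatSum a t < ⊤ := by
  have h1 : heatSum a t ≤ ENNReal.ofReal (Real.exp ((t - s) * ω)) * heatSum a s := by
    rw [heatSum, heatSum, ← ENNReal.tsum_mul_left]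
    refine ENNReal.tsum_le_tsum fun i => ?_
    rw [← ENNReal.ofReal_mul (Real.exp_pos _).le, ← Real.exp_add]
    refine ENNReal.ofReal_le_ofReal (Real.exp_le_exp.mpr ?_)
    nlinarith [ha i, mul_nonneg (sub_nonneg.mpr hst) (sub_nonneg.mpr (ha i))]
  exact h1.trans_lt (ENNReal.mul_lt_top ENNReal.ofReal_lt_top hs)

theorem count_eq_top_of_forall_eq_zero [Infinite ι] (h : ∀ i, a i = 0) {L : ℝ} (hL : 0 ≤ L) :
    count a L = ⊤ := by
  have h1 : {i | a i ≤ L} = univ := eq_univ_of_forall fun i => by simp [h i, hL]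
  rw [count, h1, infinite_univ.encard_eq, ENat.toENNReal_top]

end Laplace

section BigO

open MeasureTheory Set

/-- The `O`-relation as an eventual inequality with a real constant. -/
theorem isBigOENN_iff {α : Type*} {l : Filter α} {F : α → ℝ≥0∞} {g : α → ℝ}
    (hg : ∀ᶠ x in l, 0 < g x) :
    IsBigOENN l F g ↔ ∃ C : ℝ, 0 < C ∧ ∀ᶠ x in l, F x ≤ ENNReal.ofReal (C * g x) := by
  unfold IsBigOENN
  constructor
  · intro h
    obtain ⟨C, hC1, hC2⟩ := exists_between h
    have hC3 := eventually_lt_of_limsup_lt hC1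
    refine ⟨C.toReal + 1, by positivity, ?_⟩
    filter_upwards [hC3, hg] with x hx hgx
    rw [ENNReal.div_lt_iff (Or.inl (by simpa using hgx)) (Or.inl ENNReal.ofReal_ne_top)] at hx
    refine hx.le.trans ?_
    rw [ENNReal.ofReal_mul (by positivity)]
    gcongr
    rw [← ENNReal.ofReal_toReal hC2.ne]
    refine ENNReal.ofReal_le_ofReal ?_
    simp
  · rintro ⟨C, hC, h⟩
    refine lt_of_le_of_lt (limsup_le_of_le (h := ?_) (a := ENNReal.ofReal C))
      ENNReal.ofReal_lt_top
    filter_upwards [h, hg] with x hx hgx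
    rw [ENNReal.div_le_iff (by simpa using hgx) ENNReal.ofReal_ne_top, ← ENNReal.ofReal_mul hC.le]
    exact hx

end BigO

/-- Regular variation at infinity with index `p`, without measurability, for a function that is
only eventually positive. -/
structure RegVar (f : ℝ → ℝ) (p : ℝ) : Prop where
  eventually_pos : ∀ᶠ t in atTop, 0 < f t
  tendsto : ∀ x, 0 < x → Tendsto (fun t => f (t * x) / f t) atTop (𝓝 (x ^ p))

theorem IsRegularlyVarying.regVar {f : ℝ → ℝ} {p : ℝ} (h : IsRegularlyVarying f p) :
    RegVar f p :=
  ⟨(eventually_gt_atTop 0).mono h.pos, h.tendsto⟩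

section Abelian

open MeasureTheory Set

variable {ι : Type*} {a : ι → ℝ} {f : ℝ → ℝ} {p : ℝ}

theorem RegVar.exists_le_mul (hf : RegVar f p) {x : ℝ} (hx : 0 < x) :
    ∃ C : ℝ, 0 < C ∧ ∀ᶠ L in atTop, f (L * x) ≤ C * f L := by
  refine ⟨x ^ p + 1, by positivity, ?_⟩
  filter_upwards [hf.eventually_pos, (hf.tendsto x hx).eventually_lt_const (lt_add_one _)]
    with L hL h
  exact ((div_lt_iff₀ hL).mp h).le

/-- Iterated doubling bounds a regularly varying function along `2 ^ n * L`. -/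
theorem RegVar.exists_pow_bound (hf : RegVar f p) :
    ∃ m : ℕ, ∀ᶠ L in atTop, ∀ n : ℕ, f (L * 2 ^ n) ≤ ((2 : ℝ) ^ n) ^ m * f L := by
  obtain ⟨C, hC, h⟩ := hf.exists_le_mul two_pos
  obtain ⟨m, hm⟩ := pow_unbounded_of_one_lt C one_lt_two
  refine ⟨m, ?_⟩
  obtain ⟨Λ, hΛ⟩ := eventually_atTop.mp (h.and hf.eventually_pos)
  filter_upwards [eventually_ge_atTop Λ, eventually_ge_atTop 0] with L hL hL0 n
  induction n with
  | zero => simp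
  | succ n ih =>
    have h1 : Λ ≤ L * 2 ^ n := hL.trans (le_mul_of_one_le_right hL0 (one_le_pow₀ one_le_two))
    have h2 := (hΛ _ h1).1
    have h3 := (hΛ _ h1).2
    calc f (L * 2 ^ (n + 1)) = f (L * 2 ^ n * 2) := by rw [pow_succ, mul_assoc]
      _ ≤ C * f (L * 2 ^ n) := h2
      _ ≤ 2 ^ m * f (L * 2 ^ n) := by gcongr
      _ ≤ 2 ^ m * (((2 : ℝ) ^ n) ^ m * f L) := by gcongr
      _ = _ := by rw [pow_succ, mul_pow]; ring

theorem exists_pow_le_exp (m : ℕ) : ∃ K : ℝ, 0 < K ∧ ∀ u : ℝ, 0 ≤ u →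
    (1 + 2 * u) ^ m ≤ K * Real.exp (u / 2) := by
  refine ⟨4 ^ m * (m.factorial * Real.exp (1 / 4)), by positivity, fun u hu => ?_⟩
  have h1 := Real.pow_div_factorial_le_exp (x := (1 + 2 * u) / 4) (by positivity) m
  rw [div_le_iff₀ (by positivity), div_pow, div_le_iff₀ (by positivity)] at h1
  refine h1.trans (le_of_eq ?_)
  rw [add_div, Real.exp_add]
  have : 2 * u / 4 = u / 2 := by ring
  rw [this]; ring

/-- If the counting function is `O(f)`, then `count a (u * L)` grows in `u` slower than
`exp (u / 2) * f L`, uniformly in `L`. Monotonicity of the counting function replaces uniform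
convergence for regularly varying functions here. -/
theorem RegVar.exists_count_le (hf : RegVar f p) {C : ℝ} (hC : 0 < C)
    (hN : ∀ᶠ L in atTop, count a L ≤ ENNReal.ofReal (C * f L)) :
    ∃ K : ℝ, 0 < K ∧ ∀ᶠ L in atTop, ∀ u, 0 < u →
      count a (u * L) ≤ ENNReal.ofReal (K * Real.exp (u / 2)) * ENNReal.ofReal (f L) := by
  obtain ⟨m, hm⟩ := hf.exists_pow_bound
  obtain ⟨K, hK, hK'⟩ := exists_pow_le_exp m
  obtain ⟨Λ, hΛ⟩ := eventually_atTop.mp hN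
  refine ⟨C * K, by positivity, ?_⟩
  filter_upwards [hm, hf.eventually_pos, eventually_ge_atTop Λ, eventually_gt_atTop 0]
    with L hL hfL hLΛ hL0 u hu
  have hstep : ∀ n : ℕ, ((2 : ℝ) ^ n) ≤ 1 + 2 * u → u ≤ 2 ^ n →
      count a (u * L) ≤ ENNReal.ofReal (C * K * Real.exp (u / 2)) * ENNReal.ofReal (f L) := by
    intro n hn hn'
    have h1 : Λ ≤ L * 2 ^ n := hLΛ.trans (le_mul_of_one_le_right hL0.le (one_le_pow₀ one_le_two))
    have h2 : u * L ≤ L * 2 ^ n := by rw [mul_comm L]; gcongr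
    refine (count_mono h2).trans ((hΛ _ h1).trans ?_)
    rw [← ENNReal.ofReal_mul (by positivity)]
    refine ENNReal.ofReal_le_ofReal ?_
    calc C * f (L * 2 ^ n) ≤ C * (((2 : ℝ) ^ n) ^ m * f L) := by gcongr; exact hL n
      _ ≤ C * ((1 + 2 * u) ^ m * f L) := by gcongr
      _ ≤ C * ((K * Real.exp (u / 2)) * f L) := by gcongr; exact hK' u hu.le
      _ = _ := by ring
  rcases le_total u 1 with h | h
  · exact hstep 0 (by simp [hu.le]) (by simpa using h)
  · obtain ⟨n, hn1, hn2⟩ := exists_nat_pow_near h one_lt_two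
    exact hstep (n + 1) (by rw [pow_succ]; linarith) hn2.le

theorem lintegral_exp_neg_half : ∫⁻ u in Ioi (0 : ℝ), ENNReal.ofReal (Real.exp (-u / 2)) = 2 := by
  have h1 := exp_neg_integrableOn_Ioi 0 (b := 1 / 2) (by norm_num)
  have h2 := integral_exp_mul_Ioi (a := -(1 / 2)) (by norm_num) 0
  have h3 : ∀ u : ℝ, -u / 2 = -(1 / 2) * u := fun u => by ring
  simp_rw [h3]
  rw [← ofReal_integral_eq_lintegral_ofReal h1 (ae_of_all _ fun u => (Real.exp_pos _).le), h2]
  norm_num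

theorem ofReal_exp_mul_le {K u F : ℝ} {N : ℝ≥0∞} (hK : 0 < K)
    (h : N ≤ ENNReal.ofReal (K * Real.exp (u / 2)) * ENNReal.ofReal F) :
    ENNReal.ofReal (Real.exp (-u)) * N
      ≤ ENNReal.ofReal K * ENNReal.ofReal (Real.exp (-u / 2)) * ENNReal.ofReal F := by
  refine (mul_le_mul_right h _).trans (le_of_eq ?_)
  rw [← mul_assoc, ← ENNReal.ofReal_mul (Real.exp_pos _).le, ← ENNReal.ofReal_mul hK.le]
  congr 2
  have : -u / 2 = -u + u / 2 := by ring
  rw [this, Real.exp_add]; ring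

theorem RegVar.exists_laplaceCount_le (hf : RegVar f p) {C : ℝ} (hC : 0 < C)
    (hN : ∀ᶠ L in atTop, count a L ≤ ENNReal.ofReal (C * f L)) :
    ∃ K : ℝ, 0 < K ∧ ∀ᶠ L in atTop, laplaceCount a L ≤ ENNReal.ofReal (K * f L) := by
  obtain ⟨K, hK, h⟩ := hf.exists_count_le hC hN
  refine ⟨K * 2, by positivity, ?_⟩
  filter_upwards [h] with L hL
  have h1 : laplaceCount a L ≤ ∫⁻ u in Ioi (0 : ℝ),
      ENNReal.ofReal K * ENNReal.ofReal (Real.exp (-u / 2)) * ENNReal.ofReal (f L) :=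
    setLIntegral_mono (by fun_prop) fun u hu => ofReal_exp_mul_le hK (hL u hu)
  refine h1.trans (le_of_eq ?_)
  rw [lintegral_mul_const _ (by fun_prop), lintegral_const_mul _ (by fun_prop),
    lintegral_exp_neg_half, ENNReal.ofReal_mul (by positivity), ENNReal.ofReal_mul hK.le]
  norm_num

/-- `O`-form of the Abelian theorem. -/
theorem RegVar.exists_heatSum_le [Countable ι] {ω : ℝ} (hω : 0 ≤ ω) (ha : ∀ i, -ω ≤ a i)
    (hf : RegVar f p) {C : ℝ} (hC : 0 < C)
    (hN : ∀ᶠ L in atTop, count a L ≤ ENNReal.ofReal (C * f L)) :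
    ∃ K : ℝ, 0 < K ∧ ∀ᶠ L in atTop, heatSum a L⁻¹ ≤ ENNReal.ofReal (K * f L) := by
  obtain ⟨K, hK, h⟩ := hf.exists_laplaceCount_le hC hN
  refine ⟨Real.exp ω * K, by positivity, ?_⟩
  filter_upwards [h, eventually_ge_atTop 1] with L hL hL1
  refine (heatSum_le_laplaceCount hω ha (by linarith)).trans ?_
  rw [mul_assoc, ENNReal.ofReal_mul (Real.exp_pos _).le]
  gcongr
  exact div_le_self hω hL1

theorem lintegral_exp_neg_mul_rpow (hp : 0 ≤ p) :
    ∫⁻ u in Ioi (0 : ℝ), ENNReal.ofReal (Real.exp (-u)) * ENNReal.ofReal (u ^ p)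
      = ENNReal.ofReal (Real.Gamma (1 + p)) := by
  have h0 : 0 < 1 + p := by linarith
  rw [Real.Gamma_eq_integral h0, ofReal_integral_eq_lintegral_ofReal
    (Real.GammaIntegral_convergent h0)]
  · refine setLIntegral_congr_fun measurableSet_Ioi fun u hu => ?_
    rw [add_sub_cancel_left, ENNReal.ofReal_mul (Real.exp_pos _).le]
  · filter_upwards [ae_restrict_mem measurableSet_Ioi] with u hu
    have : 0 < u := hu
    positivity

/-- The quotient `count a (u * L) / f L` factors through `f (u * L)`. -/
theorem RegVar.eventually_count_div_eq (hf : RegVar f p) {u : ℝ} (hu : 0 < u) :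
    ∀ᶠ L in atTop, count a (L * u) / ENNReal.ofReal (f L)
      = count a (L * u) / ENNReal.ofReal (f (L * u)) * ENNReal.ofReal (f (L * u) / f L) := by
  filter_upwards [hf.eventually_pos,
    (tendsto_id.atTop_mul_const hu).eventually hf.eventually_pos] with L h1 h2
  have h2' : 0 < f (L * u) := h2
  rw [ENNReal.ofReal_div_of_pos h1, ← mul_div_assoc,
    ENNReal.div_mul_cancel (by simpa using h2') ENNReal.ofReal_ne_top]

/-- Fatou's lemma gives the lower half of the Abelian theorem. -/
theorem RegVar.le_liminf_heatSum [Countable ι] (hf : RegVar f p) (hp : 0 ≤ p) {c : ℝ}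
    (hc : ENNReal.ofReal c ≤ liminf (fun L => count a L / ENNReal.ofReal (f L)) atTop) :
    ENNReal.ofReal (c * Real.Gamma (1 + p))
      ≤ liminf (fun L => heatSum a L⁻¹ / ENNReal.ofReal (f L)) atTop := by
  have h1 : ∀ u : ℝ, 0 < u → ENNReal.ofReal c * ENNReal.ofReal (u ^ p)
      ≤ liminf (fun L => count a (u * L) / ENNReal.ofReal (f L)) atTop := by
    intro u hu
    have ht : Tendsto (fun L : ℝ => L * u) atTop atTop := tendsto_id.atTop_mul_const hu
    have h2 := (ENNReal.continuous_ofReal.tendsto _).comp (hf.tendsto u hu)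
    have h3 : liminf (fun L => count a (u * L) / ENNReal.ofReal (f L)) atTop
        = liminf ((fun L => count a (L * u) / ENNReal.ofReal (f (L * u))) *
          (fun L => ENNReal.ofReal (f (L * u) / f L))) atTop := by
      refine liminf_congr ?_
      filter_upwards [hf.eventually_count_div_eq (a := a) hu] with L hL
      rw [mul_comm u, hL]; rfl
    rw [h3]
    refine le_trans ?_ ENNReal.le_liminf_mul
    have h4 : liminf (fun L => ENNReal.ofReal (f (L * u) / f L)) atTop = ENNReal.ofReal (u ^ p) :=
      h2.liminf_eq
    rw [h4]
    gcongr
    exact hc.trans ht.liminf_le_liminf_comp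
  calc ENNReal.ofReal (c * Real.Gamma (1 + p))
      = ∫⁻ u in Ioi (0 : ℝ), ENNReal.ofReal (Real.exp (-u)) *
          (ENNReal.ofReal c * ENNReal.ofReal (u ^ p)) := by
        rw [mul_comm c, ENNReal.ofReal_mul (Real.Gamma_pos_of_pos (by linarith)).le,
          ← lintegral_exp_neg_mul_rpow hp, ← lintegral_mul_const _ (by fun_prop)]
        refine lintegral_congr fun u => ?_
        ring
    _ ≤ ∫⁻ u in Ioi (0 : ℝ), liminf (fun L => ENNReal.ofReal (Real.exp (-u)) *
          (count a (u * L) / ENNReal.ofReal (f L))) atTop := by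
        refine lintegral_mono_ae ?_
        filter_upwards [ae_restrict_mem measurableSet_Ioi] with u hu
        rw [ENNReal.liminf_const_mul_of_ne_top ENNReal.ofReal_ne_top]
        gcongr
        exact h1 u hu
    _ ≤ liminf (fun L => ∫⁻ u in Ioi (0 : ℝ), ENNReal.ofReal (Real.exp (-u)) *
          (count a (u * L) / ENNReal.ofReal (f L))) atTop := by
        refine lintegral_liminf_le fun L => ?_
        exact Measurable.mul (by fun_prop)
          ((measurable_count.comp (by fun_prop)).div_const _)
    _ ≤ liminf (fun L => heatSum a L⁻¹ / ENNReal.ofReal (f L)) atTop := by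
        refine liminf_le_liminf ?_
        filter_upwards [eventually_gt_atTop 0] with L hL
        refine le_trans (le_of_eq ?_) (ENNReal.div_le_div_right (laplaceCount_le_heatSum hL) _)
        simp_rw [div_eq_mul_inv, ← mul_assoc]
        rw [lintegral_mul_const, laplaceCount]
        exact Measurable.mul (by fun_prop) (measurable_count.comp (by fun_prop))

theorem RegVar.tendsto_heatSum [Countable ι] {ω : ℝ} (hω : 0 ≤ ω) (ha : ∀ i, -ω ≤ a i)
    (hf : RegVar f p) (hp : 0 ≤ p) {C : ℝ}
    (h : Tendsto (fun L => count a L / ENNReal.ofReal (f L)) atTop (𝓝 (ENNReal.ofReal C))) :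
    Tendsto (fun L => heatSum a L⁻¹ / ENNReal.ofReal (f L)) atTop
      (𝓝 (ENNReal.ofReal (Real.Gamma (1 + p) * C))) := by
  obtain ⟨C', hC', hN⟩ := (isBigOENN_iff hf.eventually_pos).mp
    (h.limsup_eq.trans_lt ENNReal.ofReal_lt_top)
  obtain ⟨K, hK, hK'⟩ := hf.exists_count_le hC' hN
  have hlap : Tendsto (fun L => laplaceCount a L / ENNReal.ofReal (f L)) atTop
      (𝓝 (ENNReal.ofReal (Real.Gamma (1 + p) * C))) := by
    have h1 : Tendsto (fun L => ∫⁻ u in Ioi (0 : ℝ), ENNReal.ofReal (Real.exp (-u)) *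
          (count a (u * L) / ENNReal.ofReal (f L))) atTop
        (𝓝 (∫⁻ u in Ioi (0 : ℝ), ENNReal.ofReal (Real.exp (-u)) *
          (ENNReal.ofReal C * ENNReal.ofReal (u ^ p)))) := by
      refine tendsto_lintegral_filter_of_dominated_convergence
        (fun u => ENNReal.ofReal K * ENNReal.ofReal (Real.exp (-u / 2))) ?_ ?_ ?_ ?_
      · exact Eventually.of_forall fun L => Measurable.mul (by fun_prop)
          ((measurable_count.comp (by fun_prop)).div_const _)
      · filter_upwards [hK', hf.eventually_pos] with L hL hfL
        filter_upwards [ae_restrict_mem measurableSet_Ioi] with u hu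
        rw [← mul_div_assoc, ENNReal.div_le_iff (by simpa using hfL) ENNReal.ofReal_ne_top]
        exact ofReal_exp_mul_le hK (hL u hu)
      · rw [lintegral_const_mul _ (by fun_prop), lintegral_exp_neg_half]
        exact ENNReal.mul_ne_top ENNReal.ofReal_ne_top (by norm_num)
      · filter_upwards [ae_restrict_mem measurableSet_Ioi] with u hu
        have hu' : 0 < u := hu
        refine ENNReal.Tendsto.const_mul ?_ (Or.inr ENNReal.ofReal_ne_top)
        have ht : Tendsto (fun L : ℝ => L * u) atTop atTop := tendsto_id.atTop_mul_const hu'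
        have h2 := (ENNReal.continuous_ofReal.tendsto _).comp (hf.tendsto u hu)
        have h3 := ENNReal.Tendsto.mul (h.comp ht) (Or.inr ENNReal.ofReal_ne_top) h2
          (Or.inr ENNReal.ofReal_ne_top)
        refine h3.congr' ?_
        filter_upwards [hf.eventually_count_div_eq (a := a) hu'] with L hL
        rw [mul_comm u, hL]; rfl
    have h2 : ∫⁻ u in Ioi (0 : ℝ), ENNReal.ofReal (Real.exp (-u)) *
          (ENNReal.ofReal C * ENNReal.ofReal (u ^ p))
          = ENNReal.ofReal (Real.Gamma (1 + p) * C) := by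
      rw [ENNReal.ofReal_mul (Real.Gamma_pos_of_pos (by linarith)).le,
          ← lintegral_exp_neg_mul_rpow hp, ← lintegral_mul_const _ (by fun_prop)]
      refine lintegral_congr fun u => ?_
      ring
    rw [h2] at h1
    refine h1.congr fun L => ?_
    simp_rw [div_eq_mul_inv, ← mul_assoc]
    rw [lintegral_mul_const, laplaceCount]
    exact Measurable.mul (by fun_prop) (measurable_count.comp (by fun_prop))
  have hexp : Tendsto (fun L : ℝ => ENNReal.ofReal (Real.exp (ω / L)) *
      (laplaceCount a L / ENNReal.ofReal (f L))) atTop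
      (𝓝 (ENNReal.ofReal (Real.Gamma (1 + p) * C))) := by
    have h1 : Tendsto (fun L : ℝ => Real.exp (ω / L)) atTop (𝓝 1) := by
      have := (Real.continuous_exp.tendsto 0).comp
        (tendsto_const_nhds (x := ω) |>.div_atTop tendsto_id)
      simpa [Function.comp_def] using this
    have h2 := (ENNReal.continuous_ofReal.tendsto _).comp h1
    have h3 := ENNReal.Tendsto.mul h2 (Or.inr ENNReal.ofReal_ne_top) hlap
      (Or.inr ENNReal.ofReal_ne_top)
    rw [ENNReal.ofReal_one, one_mul] at h3
    exact h3
  refine tendsto_of_tendsto_of_tendsto_of_le_of_le' hlap hexp ?_ ?_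
  · filter_upwards [eventually_gt_atTop 0] with L hL
    exact ENNReal.div_le_div_right (laplaceCount_le_heatSum hL) _
  · filter_upwards [eventually_gt_atTop 0] with L hL
    rw [← mul_div_assoc]
    exact ENNReal.div_le_div_right (heatSum_le_laplaceCount hω ha hL) _

end Abelian

/-! ### A lower bound for the counting function -/

section LowerBound

open MeasureTheory Set

variable {ι : Type*} {a : ι → ℝ} {f : ℝ → ℝ} {p : ℝ}

/-- Two-sided bounds on the exponential sum force a lower bound on the counting function: after
the levels beyond `M * L` have been discarded, with `M` large, half of the sum is left. -/
theorem RegVar.liminf_count_pos {ω : ℝ} (hω : 0 ≤ ω) (ha : ∀ i, -ω ≤ a i) (hf : RegVar f p)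
    (hpos : 0 < liminf (fun L => heatSum a L⁻¹ / ENNReal.ofReal (f L)) atTop) {C : ℝ}
    (hC : 0 < C) (hO : ∀ᶠ L in atTop, heatSum a L⁻¹ ≤ ENNReal.ofReal (C * f L)) :
    0 < liminf (fun L => count a L / ENNReal.ofReal (f L)) atTop := by
  obtain ⟨c', hc0', hc1⟩ := exists_between hpos
  have hctop : c' ≠ ⊤ := hc1.ne_top
  set c := c'.toReal with hcdef
  have hc0 : 0 < c := ENNReal.toReal_pos hc0'.ne' hctop
  have hcc : ENNReal.ofReal c = c' := ENNReal.ofReal_toReal hctop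
  have hlow := eventually_lt_of_lt_liminf hc1
  obtain ⟨D, hD, hfD⟩ := hf.exists_le_mul two_pos
  obtain ⟨M, hM0, hM⟩ : ∃ M : ℝ, 0 < M ∧ Real.exp (-M / 2) * (C * D) ≤ c / 2 := by
    have h1 : Tendsto (fun M : ℝ => Real.exp (-M / 2) * (C * D)) atTop (𝓝 0) := by
      have h2 : Tendsto (fun M : ℝ => -M / 2) atTop atBot :=
        (tendsto_neg_atTop_atBot).atBot_div_const two_pos
      simpa using (Real.tendsto_exp_atBot.comp h2).mul_const (C * D)
    obtain ⟨M, h3, h4⟩ := ((h1.eventually_le_const (by positivity : (0 : ℝ) < c / 2)).and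
      (eventually_gt_atTop 0)).exists
    exact ⟨M, h4, h3⟩
  obtain ⟨E, hE, hfE⟩ := hf.exists_le_mul hM0
  have hkey : ∀ᶠ L in atTop, ENNReal.ofReal (c / (2 * E * Real.exp ω)) * ENNReal.ofReal (f (L * M))
      ≤ count a (L * M) := by
    filter_upwards [hlow, hfD, hfE, hf.eventually_pos, eventually_ge_atTop 1,
      (tendsto_id.atTop_mul_const two_pos).eventually hO] with L h1 h2 h3 h4 h5 h6
    have hL : 0 < L := by linarith
    rw [ENNReal.lt_div_iff_mul_lt (Or.inl (by simpa using h4)) (Or.inl ENNReal.ofReal_ne_top),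
      ← hcc, ← ENNReal.ofReal_mul hc0.le] at h1
    have h7 : ENNReal.ofReal (Real.exp (-M / 2)) * heatSum a (2 * L)⁻¹
        ≤ ENNReal.ofReal (c / 2 * f L) := by
      have h6' : heatSum a (2 * L)⁻¹ ≤ ENNReal.ofReal (C * f (L * 2)) := by
        rw [mul_comm 2 L]; exact h6
      refine (mul_le_mul_right h6' _).trans ?_
      rw [← ENNReal.ofReal_mul (Real.exp_pos _).le]
      refine ENNReal.ofReal_le_ofReal ?_
      calc Real.exp (-M / 2) * (C * f (L * 2)) ≤ Real.exp (-M / 2) * (C * (D * f L)) := by gcongr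
        _ = Real.exp (-M / 2) * (C * D) * f L := by ring
        _ ≤ _ := by gcongr
    have h8 := h1.le.trans ((heatSum_le_add ha M hL).trans (add_le_add_right h7 _))
    have h9 : ENNReal.ofReal (c * f L)
        = ENNReal.ofReal (c / 2 * f L) + ENNReal.ofReal (c / 2 * f L) := by
      rw [← ENNReal.ofReal_add (by positivity) (by positivity)]; ring_nf
    rw [h9] at h8
    have h10 := (ENNReal.add_le_add_iff_right ENNReal.ofReal_ne_top).mp h8
    have h11 : ENNReal.ofReal (c / (2 * E * Real.exp ω)) * ENNReal.ofReal (f (L * M))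
        ≤ ENNReal.ofReal (Real.exp (-ω)) * ENNReal.ofReal (c / 2 * f L) := by
      rw [← ENNReal.ofReal_mul (by positivity), ← ENNReal.ofReal_mul (by positivity)]
      refine ENNReal.ofReal_le_ofReal ?_
      rw [Real.exp_neg]
      calc c / (2 * E * Real.exp ω) * f (L * M) ≤ c / (2 * E * Real.exp ω) * (E * f L) := by gcongr
        _ = _ := by field_simp
    refine h11.trans ((mul_le_mul_right h10 _).trans ?_)
    rw [← mul_assoc, ← ENNReal.ofReal_mul (Real.exp_pos _).le, ← Real.exp_add, mul_comm M]
    have h12 : ENNReal.ofReal (Real.exp (-ω + ω / L)) ≤ 1 := by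
      rw [ENNReal.ofReal_le_one, Real.exp_le_one_iff]
      have := div_le_self hω h5
      linarith
    exact mul_le_of_le_one_left zero_le h12
  have hpos' : 0 < ENNReal.ofReal (c / (2 * E * Real.exp ω)) :=
    ENNReal.ofReal_pos.mpr (by positivity)
  refine hpos'.trans_le (le_liminf_of_le (h := ?_))
  have ht : Tendsto (fun L : ℝ => L / M) atTop atTop := tendsto_id.atTop_div_const hM0
  filter_upwards [ht.eventually hkey, hf.eventually_pos] with L hL hfL
  rw [div_mul_cancel₀ L hM0.ne'] at hL
  rwa [ENNReal.le_div_iff_mul_le (Or.inl (by simpa using hfL)) (Or.inl ENNReal.ofReal_ne_top)]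

end LowerBound

/-! ### Polynomial approximation of step functions -/

section Tauberian

open MeasureTheory Set

variable {p : ℝ}

/-- The measure with distribution function `s ^ p` on the half-line, a point mass at `0` for
`p = 0`, together with its Laplace transform at the positive integers. -/
theorem exists_measure_Iic_eq_rpow (hp : 0 ≤ p) : ∃ ν : Measure ℝ, (∀ᵐ u ∂ν, 0 ≤ u) ∧
    (∀ s, 0 < s → ν (Iic s) = ENNReal.ofReal (s ^ p)) ∧
    ∀ n : ℕ, Integrable (fun u => Real.exp (-u) ^ (n + 1)) ν ∧
      ∫ u, Real.exp (-u) ^ (n + 1) ∂ν = Real.Gamma (1 + p) * ((n + 1 : ℝ)⁻¹) ^ p := by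
  rcases hp.eq_or_lt with rfl | hp0
  · refine ⟨Measure.dirac 0, by simp [ae_dirac_eq], fun s hs => ?_, fun n => ⟨?_, ?_⟩⟩
    · rw [Measure.dirac_apply' _ measurableSet_Iic]
      simp [hs.le]
    · exact integrable_dirac (by simp)
    · simp
  · set d : ℝ → ℝ≥0∞ := fun u => ENNReal.ofReal (p * u ^ (p - 1)) with hd
    have hdm : Measurable d := by fun_prop
    have hexp : ∀ (n : ℕ) (u : ℝ), Real.exp (-u) ^ (n + 1) = Real.exp (-((n + 1 : ℝ) * u)) := by
      intro n u
      rw [← Real.exp_nat_mul]; congr 1; push_cast; ring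
    have hint : ∀ n : ℕ, IntegrableOn (fun u : ℝ => u ^ (p - 1) * Real.exp (-((n + 1 : ℝ) * u)))
        (Ioi 0) := by
      intro n
      have := integrableOn_rpow_mul_exp_neg_mul_rpow (p := 1) (s := p - 1) (b := n + 1)
        (by linarith) one_pos (by positivity)
      simpa only [Real.rpow_one, neg_mul] using this
    have hcongr : ∀ (n : ℕ) (u : ℝ), u ∈ Ioi (0 : ℝ) → (d u).toReal • Real.exp (-u) ^ (n + 1)
        = p * (u ^ (p - 1) * Real.exp (-((n + 1 : ℝ) * u))) := by
      intro n u hu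
      have hu' : (0 : ℝ) < u := hu
      rw [hd, ENNReal.toReal_ofReal (by positivity), hexp, smul_eq_mul, mul_assoc]
    refine ⟨(volume.restrict (Ioi 0)).withDensity d, ?_, ?_, fun n => ⟨?_, ?_⟩⟩
    · refine (withDensity_absolutelyContinuous _ _).ae_le ?_
      filter_upwards [ae_restrict_mem measurableSet_Ioi] with u hu using le_of_lt hu
    · intro s hs
      rw [withDensity_apply _ measurableSet_Iic, Measure.restrict_restrict measurableSet_Iic,
        Iic_inter_Ioi]
      have h1 : IntegrableOn (fun u : ℝ => p * u ^ (p - 1)) (Ioc 0 s) := by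
        have := (intervalIntegral.intervalIntegrable_rpow' (a := 0) (b := s)
          (by linarith : -1 < p - 1)).const_mul p
        rwa [intervalIntegrable_iff_integrableOn_Ioc_of_le hs.le] at this
      rw [hd, ← ofReal_integral_eq_lintegral_ofReal h1]
      · congr 1
        rw [← intervalIntegral.integral_of_le hs.le, intervalIntegral.integral_const_mul,
          integral_rpow (Or.inl (by linarith)), sub_add_cancel, Real.zero_rpow hp0.ne', sub_zero,
          mul_div_cancel₀ _ hp0.ne']
      · filter_upwards [ae_restrict_mem measurableSet_Ioc] with u hu
        have := hu.1
        positivity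
    · rw [integrable_withDensity_iff_integrable_smul' hdm
        (ae_of_all _ fun u => ENNReal.ofReal_lt_top)]
      refine IntegrableOn.congr_fun ((hint n).const_mul p) (fun u hu => ?_) measurableSet_Ioi
      exact (hcongr n u hu).symm
    · rw [integral_withDensity_eq_integral_toReal_smul hdm
        (ae_of_all _ fun u => ENNReal.ofReal_lt_top),
        setIntegral_congr_fun measurableSet_Ioi (hcongr n), integral_const_mul,
        Real.integral_rpow_mul_exp_neg_mul_Ioi hp0 (by positivity), add_comm 1 p,
        Real.Gamma_add_one hp0.ne', one_div]
      ring

variable {ν : Measure ℝ}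

theorem integrable_exp_mul_eval
    (hint : ∀ n : ℕ, Integrable (fun u => Real.exp (-u) ^ (n + 1)) ν) (P : Polynomial ℝ) :
    Integrable (fun u => Real.exp (-u) * P.eval (Real.exp (-u))) ν := by
  have h1 : (fun u => Real.exp (-u) * P.eval (Real.exp (-u))) = fun u =>
      ∑ n ∈ Finset.range (P.natDegree + 1), P.coeff n * Real.exp (-u) ^ (n + 1) := by
    funext u
    rw [Polynomial.eval_eq_sum_range, Finset.mul_sum]
    refine Finset.sum_congr rfl fun n _ => ?_
    ring
  rw [h1]
  exact integrable_finsetSum _ fun n _ => (hint n).const_mul _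

theorem integral_exp_mul_eval
    (hint : ∀ n : ℕ, Integrable (fun u => Real.exp (-u) ^ (n + 1)) ν) (P : Polynomial ℝ) :
    ∫ u, Real.exp (-u) * P.eval (Real.exp (-u)) ∂ν
      = ∑ n ∈ Finset.range (P.natDegree + 1), P.coeff n * ∫ u, Real.exp (-u) ^ (n + 1) ∂ν := by
  have h1 : (fun u => Real.exp (-u) * P.eval (Real.exp (-u))) = fun u =>
      ∑ n ∈ Finset.range (P.natDegree + 1), P.coeff n * Real.exp (-u) ^ (n + 1) := by
    funext u
    rw [Polynomial.eval_eq_sum_range, Finset.mul_sum]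
    refine Finset.sum_congr rfl fun n _ => ?_
    ring
  rw [h1, integral_finsetSum _ fun n _ => (hint n).const_mul _]
  simp_rw [integral_const_mul]

/-- Karamata's approximation of a step function: polynomials `P`, `Q` with `x * P x` below and
`x * Q x` above steps at `exp (-s₁) < exp (-s₂)`, with controlled integrals. The functions live on
`[0, 2]` and not `[0, 1]` in order to leave room for negative members of a family. -/
theorem exists_polynomial_step (h0 : ∀ᵐ u ∂ν, 0 ≤ u)
    (hν : ∀ s, 0 < s → ν (Iic s) = ENNReal.ofReal (s ^ p))
    (hint : ∀ n : ℕ, Integrable (fun u => Real.exp (-u) ^ (n + 1)) ν)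
    {s₁ s₂ η : ℝ} (hs₂ : 0 < s₂) (hs : s₂ < s₁) (hη : 0 < η) :
    ∃ P Q : Polynomial ℝ,
      (∀ x ∈ Icc (0 : ℝ) 2, (x ≤ Real.exp (-s₁) → x * P.eval x ≤ 0) ∧ x * P.eval x ≤ 1 ∧
        0 ≤ x * Q.eval x ∧ (Real.exp (-s₂) ≤ x → 1 ≤ x * Q.eval x)) ∧
      s₂ ^ p - η ≤ ∫ u, Real.exp (-u) * P.eval (Real.exp (-u)) ∂ν ∧
      ∫ u, Real.exp (-u) * Q.eval (Real.exp (-u)) ∂ν ≤ s₁ ^ p + η := by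
  set α := Real.exp (-s₁) with hα
  set β := Real.exp (-s₂) with hβ
  have hα0 : 0 < α := Real.exp_pos _
  have hαβ : α < β := Real.exp_lt_exp.mpr (by linarith)
  have hs₁ : 0 < s₁ := hs₂.trans hs
  let g : ℝ → ℝ := fun x => max 0 (min 1 ((x - α) / (β - α)))
  let h : ℝ → ℝ := fun x => g x / max x α
  have hmax : ∀ x : ℝ, 0 < max x α := fun x => lt_max_of_lt_right hα0
  have hg0 : ∀ x, 0 ≤ g x := fun x => le_max_left _ _
  have hg1 : ∀ x, g x ≤ 1 := fun x => max_le zero_le_one (min_le_left _ _)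
  have hgα : ∀ x, x ≤ α → g x = 0 := fun x hx => max_eq_left ((min_le_right _ _).trans
    (div_nonpos_of_nonpos_of_nonneg (by linarith) (by linarith)))
  have hgβ : ∀ x, β ≤ x → g x = 1 := by
    intro x hx
    have h1 : 1 ≤ (x - α) / (β - α) := by rw [le_div_iff₀ (by linarith)]; linarith
    simp [g, min_eq_left h1]
  have hcont : Continuous h := by
    have hgc : Continuous g := by fun_prop
    exact hgc.div (by fun_prop) fun x => (hmax x).ne'
  have hxh : ∀ x, x * h x = g x := by
    intro x
    rcases le_total x α with hx | hx
    · simp [h, hgα x hx]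
    · simp only [h, max_eq_left hx]
      rw [mul_div_cancel₀ _ (hα0.trans_le hx).ne']
  set I := ∫ u, Real.exp (-u) ∂ν with hI
  have hI1 : Integrable (fun u => Real.exp (-u)) ν := by simpa using hint 0
  have hI0 : 0 ≤ I := integral_nonneg fun u => (Real.exp_pos _).le
  set δ := η / (2 * (I + 1)) with hδ
  have hδ0 : 0 < δ := by positivity
  have hδI : 2 * δ * I ≤ η := by
    have h1 : 2 * δ * I = η * (I / (I + 1)) := by rw [hδ]; field_simp
    rw [h1]
    exact mul_le_of_le_one_right hη.le ((div_le_one (by linarith)).mpr (by linarith))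
  obtain ⟨q, hq⟩ := exists_polynomial_near_of_continuousOn 0 2 h hcont.continuousOn δ hδ0
  have hind : ∀ s, 0 < s → ∫ u, (Iic s).indicator (1 : ℝ → ℝ) u ∂ν = s ^ p := by
    intro s hs
    rw [integral_indicator_one measurableSet_Iic, measureReal_def, hν s hs,
      ENNReal.toReal_ofReal (by positivity)]
  have hindi : ∀ s, 0 < s → Integrable ((Iic s).indicator (1 : ℝ → ℝ)) ν := by
    intro s hs
    refine (integrable_indicator_iff measurableSet_Iic).mpr ?_
    refine integrableOn_const ?_ (by simp)
    rw [hν s hs]; exact ENNReal.ofReal_ne_top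
  have hexp : ∀ᵐ u ∂ν, Real.exp (-u) ∈ Icc (0 : ℝ) 2 := by
    filter_upwards [h0] with u hu
    refine ⟨(Real.exp_pos _).le, ?_⟩
    have : Real.exp (-u) ≤ 1 := Real.exp_le_one_iff.mpr (by linarith)
    linarith
  refine ⟨q - Polynomial.C δ, q + Polynomial.C δ, ?_, ?_, ?_⟩
  · intro x hx
    have h1 := abs_lt.mp (hq x hx)
    have h2 : x * (q - Polynomial.C δ).eval x ≤ g x := by
      rw [← hxh]
      refine mul_le_mul_of_nonneg_left ?_ hx.1
      simp; linarith
    have h3 : g x ≤ x * (q + Polynomial.C δ).eval x := by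
      rw [← hxh]
      refine mul_le_mul_of_nonneg_left ?_ hx.1
      simp; linarith
    exact ⟨fun hx' => h2.trans (hgα x hx').le, h2.trans (hg1 x), (hg0 x).trans h3,
      fun hx' => (hgβ x hx').ge.trans h3⟩
  · have h1 : ∫ u, ((Iic s₂).indicator (1 : ℝ → ℝ) u - 2 * δ * Real.exp (-u)) ∂ν
        ≤ ∫ u, Real.exp (-u) * (q - Polynomial.C δ).eval (Real.exp (-u)) ∂ν := by
      refine integral_mono_ae ((hindi s₂ hs₂).sub (hI1.const_mul _))
        (integrable_exp_mul_eval hint _) ?_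
      filter_upwards [hexp] with u hu
      have h2 := abs_lt.mp (hq _ hu)
      have h3 : (Iic s₂).indicator (1 : ℝ → ℝ) u ≤ g (Real.exp (-u)) := by
        by_cases hus : u ≤ s₂
        · rw [indicator_of_mem (mem_Iic.mpr hus), hgβ _ (Real.exp_le_exp.mpr (neg_le_neg hus)),
            Pi.one_apply]
        · rw [indicator_of_notMem (by simpa using hus)]; exact hg0 _
      rw [← hxh] at h3
      simp only [Polynomial.eval_sub, Polynomial.eval_C]
      nlinarith [Real.exp_pos (-u)]
    rw [integral_sub (hindi s₂ hs₂) (hI1.const_mul _), hind s₂ hs₂, integral_const_mul, ← hI] at h1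
    linarith
  · have h1 : ∫ u, Real.exp (-u) * (q + Polynomial.C δ).eval (Real.exp (-u)) ∂ν
        ≤ ∫ u, ((Iic s₁).indicator (1 : ℝ → ℝ) u + 2 * δ * Real.exp (-u)) ∂ν := by
      refine integral_mono_ae (integrable_exp_mul_eval hint _)
        ((hindi s₁ hs₁).add (hI1.const_mul _)) ?_
      filter_upwards [hexp] with u hu
      have h2 := abs_lt.mp (hq _ hu)
      have h3 : g (Real.exp (-u)) ≤ (Iic s₁).indicator (1 : ℝ → ℝ) u := by
        by_cases hus : u ≤ s₁
        · rw [indicator_of_mem (mem_Iic.mpr hus)]; exact hg1 _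
        · rw [indicator_of_notMem (by simpa using hus)]
          exact (hgα _ (Real.exp_le_exp.mpr (by linarith))).le
      rw [← hxh] at h3
      simp only [Polynomial.eval_add, Polynomial.eval_C]
      nlinarith [Real.exp_pos (-u)]
    rw [integral_add (hindi s₁ hs₁) (hI1.const_mul _), hind s₁ hs₁, integral_const_mul, ← hI] at h1
    linarith

end Tauberian

/-! ### Karamata's Tauberian theorem -/

section Karamata

open MeasureTheory Set

variable {ι : Type*} {a : ι → ℝ} {f : ℝ → ℝ} {p : ℝ}

theorem exp_pow_eq {L : ℝ} (n : ℕ) (x : ℝ) :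
    Real.exp (-L⁻¹ * x) ^ (n + 1) = Real.exp (-(L * (n + 1 : ℝ)⁻¹)⁻¹ * x) := by
  rw [← Real.exp_nat_mul, mul_inv, inv_inv]
  congr 1
  push_cast; ring

theorem summable_exp_of_heatSum_lt_top {t : ℝ} (h : heatSum a t < ⊤) :
    Summable fun i => Real.exp (-t * a i) := by
  have h1 := ENNReal.summable_toReal h.ne
  refine h1.congr fun i => ?_
  rw [ENNReal.toReal_ofReal (Real.exp_pos _).le]

theorem toReal_heatSum (t : ℝ) : (heatSum a t).toReal = ∑' i, Real.exp (-t * a i) := by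
  rw [heatSum, ENNReal.tsum_toReal_eq fun i => ENNReal.ofReal_ne_top]
  refine tsum_congr fun i => ?_
  rw [ENNReal.toReal_ofReal (Real.exp_pos _).le]

theorem toReal_count (L : ℝ) :
    (count a L).toReal = ∑' i, if a i ≤ L then (1 : ℝ) else 0 := by
  rw [count_eq_tsum, ENNReal.tsum_toReal_eq fun i => by split_ifs <;> simp]
  refine tsum_congr fun i => ?_
  split_ifs <;> simp

theorem summable_count {L : ℝ} (h : count a L < ⊤) :
    Summable fun i => if a i ≤ L then (1 : ℝ) else 0 := by
  rw [count_eq_tsum] at h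
  refine (ENNReal.summable_toReal h.ne).congr fun i => ?_
  split_ifs <;> simp

theorem eventually_lt_top_of_tendsto_div {F : ℝ → ℝ≥0∞} {l : Filter ℝ} {c : ℝ}
    (h : Tendsto (fun L => F L / ENNReal.ofReal (f L)) l (𝓝 (ENNReal.ofReal c))) :
    ∀ᶠ L in l, F L < ⊤ := by
  filter_upwards [h.eventually_lt_const ENNReal.ofReal_lt_top] with L hL
  by_contra hF
  rw [not_lt_top_iff.mp hF, ENNReal.top_div_of_ne_top ENNReal.ofReal_ne_top] at hL
  exact lt_irrefl _ hL

theorem tendsto_toReal_div {F : ℝ → ℝ≥0∞} {l : Filter ℝ} {c : ℝ} (hc : 0 ≤ c)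
    (hf : ∀ᶠ L in l, 0 < f L)
    (h : Tendsto (fun L => F L / ENNReal.ofReal (f L)) l (𝓝 (ENNReal.ofReal c))) :
    Tendsto (fun L => (F L).toReal / f L) l (𝓝 c) := by
  have h1 := (ENNReal.tendsto_toReal ENNReal.ofReal_ne_top).comp h
  rw [ENNReal.toReal_ofReal hc] at h1
  refine h1.congr' ?_
  filter_upwards [hf] with L hL
  simp [ENNReal.toReal_div, ENNReal.toReal_ofReal hL.le]

theorem tendsto_div_of_tendsto_toReal_div {F : ℝ → ℝ≥0∞} {l : Filter ℝ} {c : ℝ}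
    (hf : ∀ᶠ L in l, 0 < f L) (hF : ∀ᶠ L in l, F L < ⊤)
    (h : Tendsto (fun L => (F L).toReal / f L) l (𝓝 c)) :
    Tendsto (fun L => F L / ENNReal.ofReal (f L)) l (𝓝 (ENNReal.ofReal c)) := by
  refine (ENNReal.tendsto_ofReal h).congr' ?_
  filter_upwards [hf, hF] with L hL hFL
  rw [ENNReal.ofReal_div_of_pos hL, ENNReal.ofReal_toReal hFL.ne]

/-- Karamata's Tauberian theorem: the limits of the exponential sums at the scales `L / (n + 1)`
determine those of all sums of polynomials in `exp (-a i / L)`, and these approximate the counting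
function. -/
theorem RegVar.tendsto_count {ω : ℝ} (ha : ∀ i, -ω ≤ a i)
    (hf : RegVar f p) (hp : 0 ≤ p) {C : ℝ} (hC : 0 ≤ C)
    (h : Tendsto (fun L => heatSum a L⁻¹ / ENNReal.ofReal (f L)) atTop
      (𝓝 (ENNReal.ofReal (Real.Gamma (1 + p) * C)))) :
    Tendsto (fun L => count a L / ENNReal.ofReal (f L)) atTop (𝓝 (ENNReal.ofReal C)) := by
  -- The reference measure `ν` carries the limits: `ν (Iic s) = s ^ p`.
  obtain ⟨ν, h0, hν, hmom⟩ := exists_measure_Iic_eq_rpow hp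
  have hint := fun n => (hmom n).1
  have hΓ : 0 < Real.Gamma (1 + p) := Real.Gamma_pos_of_pos (by linarith)
  have hfin : ∀ᶠ L in atTop, heatSum a L⁻¹ < ⊤ := eventually_lt_top_of_tendsto_div h
  have hreal := tendsto_toReal_div (mul_nonneg hΓ.le hC) hf.eventually_pos h
  have hscale : ∀ n : ℕ, Tendsto (fun L : ℝ => L * (n + 1 : ℝ)⁻¹) atTop atTop := fun n =>
    tendsto_id.atTop_mul_const (by positivity)
  have hsum : ∀ n : ℕ, ∀ᶠ L in atTop, Summable fun i => Real.exp (-L⁻¹ * a i) ^ (n + 1) := by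
    intro n
    filter_upwards [(hscale n).eventually hfin] with L hL
    simp_rw [exp_pow_eq]
    exact summable_exp_of_heatSum_lt_top hL
  have hmono : ∀ n : ℕ, Tendsto (fun L => (∑' i, Real.exp (-L⁻¹ * a i) ^ (n + 1)) / f L) atTop
      (𝓝 (C * ∫ u, Real.exp (-u) ^ (n + 1) ∂ν)) := by
    intro n
    have h1 := (hreal.comp (hscale n)).mul (hf.tendsto (n + 1 : ℝ)⁻¹ (by positivity))
    have h2 : Real.Gamma (1 + p) * C * ((n + 1 : ℝ)⁻¹) ^ p
        = C * ∫ u, Real.exp (-u) ^ (n + 1) ∂ν := by rw [(hmom n).2]; ring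
    rw [h2] at h1
    refine h1.congr' ?_
    filter_upwards [hf.eventually_pos, (hscale n).eventually hf.eventually_pos] with L hL hL'
    simp_rw [exp_pow_eq]
    rw [← toReal_heatSum, Function.comp_apply]
    exact div_mul_div_cancel₀ hL'.ne'
  have hpoly : ∀ P : Polynomial ℝ,
      (∀ᶠ L in atTop, Summable fun i => Real.exp (-L⁻¹ * a i) * P.eval (Real.exp (-L⁻¹ * a i))) ∧
      Tendsto (fun L => (∑' i, Real.exp (-L⁻¹ * a i) * P.eval (Real.exp (-L⁻¹ * a i))) / f L) atTop
        (𝓝 (C * ∫ u, Real.exp (-u) * P.eval (Real.exp (-u)) ∂ν)) := by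
    intro P
    have h1 : ∀ x : ℝ, x * P.eval x
        = ∑ n ∈ Finset.range (P.natDegree + 1), P.coeff n * x ^ (n + 1) := by
      intro x
      rw [Polynomial.eval_eq_sum_range, Finset.mul_sum]
      refine Finset.sum_congr rfl fun n _ => ?_
      ring
    have hall : ∀ᶠ L in atTop, ∀ n ∈ Finset.range (P.natDegree + 1),
        Summable fun i => P.coeff n * Real.exp (-L⁻¹ * a i) ^ (n + 1) := by
      rw [eventually_all_finset]
      intro n _
      exact (hsum n).mono fun L hL => hL.mul_left _
    constructor
    · filter_upwards [hall] with L hL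
      simp_rw [h1]
      exact summable_sum hL
    · rw [integral_exp_mul_eval hint, Finset.mul_sum]
      have h2 := tendsto_finsetSum (Finset.range (P.natDegree + 1)) fun n _ =>
        (hmono n).const_mul (P.coeff n)
      have h3 : ∀ n, C * (P.coeff n * ∫ u, Real.exp (-u) ^ (n + 1) ∂ν)
          = P.coeff n * (C * ∫ u, Real.exp (-u) ^ (n + 1) ∂ν) := fun n => by ring
      simp_rw [h3]
      refine h2.congr' ?_
      filter_upwards [hall] with L hL
      simp_rw [h1]
      rw [Summable.tsum_finsetSum hL, Finset.sum_div]
      refine Finset.sum_congr rfl fun n _ => ?_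
      rw [tsum_mul_left, mul_div_assoc]
  have hcfin : ∀ᶠ L in atTop, count a L < ⊤ := by
    filter_upwards [hfin, eventually_gt_atTop 0] with L hL hL0
    have h1 := count_le_heatSum (a := a) 1 hL0
    rw [one_mul] at h1
    exact h1.trans_lt (ENNReal.mul_lt_top ENNReal.ofReal_lt_top hL)
  have hmem : ∀ᶠ L in atTop, ∀ i, Real.exp (-L⁻¹ * a i) ∈ Icc (0 : ℝ) 2 := by
    have h1 : Tendsto (fun L : ℝ => Real.exp (L⁻¹ * ω)) atTop (𝓝 1) := by
      have := (Real.continuous_exp.tendsto _).comp (tendsto_inv_atTop_zero.mul_const ω)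
      simpa [Function.comp_def] using this
    filter_upwards [h1.eventually_le_const one_lt_two, eventually_gt_atTop 0] with L hL hL0 i
    refine ⟨(Real.exp_pos _).le, le_trans (Real.exp_le_exp.mpr ?_) hL⟩
    have : 0 < L⁻¹ := inv_pos.mpr hL0
    nlinarith [ha i]
  have hlevel : ∀ L : ℝ, 0 < L → ∀ i, a i ≤ L ↔ Real.exp (-1) ≤ Real.exp (-L⁻¹ * a i) := by
    intro L hL i
    rw [Real.exp_le_exp, neg_mul, neg_le_neg_iff, ← div_eq_inv_mul, div_le_one hL]
  refine tendsto_div_of_tendsto_toReal_div hf.eventually_pos hcfin ?_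
  have hpow : ∀ η : ℝ, 0 < η → ∃ s₂ s₁ : ℝ, 0 < s₂ ∧ s₂ < 1 ∧ 1 < s₁ ∧
      1 - η < s₂ ^ p ∧ s₁ ^ p < 1 + η := by
    intro η hη
    have h1 : Tendsto (fun s : ℝ => s ^ p) (𝓝 1) (𝓝 1) := by
      have := (Real.continuousAt_rpow_const 1 p (Or.inl one_ne_zero)).tendsto
      rwa [Real.one_rpow] at this
    obtain ⟨s₂, hs2, hs2', hs2''⟩ := (((h1.mono_left nhdsWithin_le_nhds).eventually_const_lt
      (by linarith : 1 - η < 1)).and (Ioo_mem_nhdsLT (zero_lt_one (α := ℝ)))).exists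
    obtain ⟨s₁, hs1, hs1'⟩ := (((h1.mono_left nhdsWithin_le_nhds).eventually_lt_const
      (by linarith : 1 < 1 + η)).and (self_mem_nhdsWithin (s := Ioi (1 : ℝ)))).exists
    exact ⟨s₂, s₁, hs2', hs2'', hs1', hs2, hs1⟩
  refine tendsto_order.mpr ⟨fun b hb => ?_, fun b hb => ?_⟩
  · set η := (C - b) / (2 * (C + 1)) with hη
    have hη0 : 0 < η := div_pos (by linarith) (by linarith)
    have hηC : C * (2 * η) < C - b := by
      have h1 : C * (2 * η) = (C - b) * (C / (C + 1)) := by rw [hη]; field_simp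
      rw [h1]
      exact mul_lt_of_lt_one_right (by linarith) ((div_lt_one (by linarith)).mpr (by linarith))
    obtain ⟨s₂, _, hs0, hs1, _, hs2, _⟩ := hpow η hη0
    obtain ⟨P, _, hPQ, hP, _⟩ := exists_polynomial_step h0 hν hint hs0 hs1 hη0
    obtain ⟨hsP, htP⟩ := hpoly P
    have hlt : b < C * ∫ u, Real.exp (-u) * P.eval (Real.exp (-u)) ∂ν := by
      have h1 : C * (1 - 2 * η) ≤ C * ∫ u, Real.exp (-u) * P.eval (Real.exp (-u)) ∂ν :=
        mul_le_mul_of_nonneg_left (by linarith) hC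
      linarith
    filter_upwards [htP.eventually_const_lt hlt, hsP, hcfin, hmem, hf.eventually_pos,
      eventually_gt_atTop 0] with L h1 h2 h3 h4 h5 h6
    refine h1.trans_le (div_le_div_of_nonneg_right ?_ h5.le)
    rw [toReal_count]
    refine h2.tsum_le_tsum (fun i => ?_) (summable_count h3)
    split_ifs with h7
    · exact (hPQ _ (h4 i)).2.1
    · rw [hlevel L h6 i, not_le] at h7
      exact (hPQ _ (h4 i)).1 h7.le
  · set η := (b - C) / (2 * (C + 1)) with hη
    have hη0 : 0 < η := div_pos (by linarith) (by linarith)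
    have hηC : C * (2 * η) < b - C := by
      have h1 : C * (2 * η) = (b - C) * (C / (C + 1)) := by rw [hη]; field_simp
      rw [h1]
      exact mul_lt_of_lt_one_right (by linarith) ((div_lt_one (by linarith)).mpr (by linarith))
    obtain ⟨_, s₁, _, _, hs1, _, hs2⟩ := hpow η hη0
    obtain ⟨_, Q, hPQ, _, hQ⟩ := exists_polynomial_step h0 hν hint one_pos hs1 hη0
    obtain ⟨hsQ, htQ⟩ := hpoly Q
    have hlt : C * ∫ u, Real.exp (-u) * Q.eval (Real.exp (-u)) ∂ν < b := by
      have h1 : C * ∫ u, Real.exp (-u) * Q.eval (Real.exp (-u)) ∂ν ≤ C * (1 + 2 * η) :=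
        mul_le_mul_of_nonneg_left (by linarith) hC
      linarith
    filter_upwards [htQ.eventually_lt_const hlt, hsQ, hcfin, hmem, hf.eventually_pos,
      eventually_gt_atTop 0] with L h1 h2 h3 h4 h5 h6
    refine lt_of_le_of_lt (div_le_div_of_nonneg_right ?_ h5.le) h1
    rw [toReal_count]
    refine (summable_count h3).tsum_le_tsum (fun i => ?_) h2
    split_ifs with h7
    · rw [hlevel L h6 i] at h7
      exact (hPQ _ (h4 i)).2.2.2 h7
    · exact (hPQ _ (h4 i)).2.2.1

end Karamata

/-! ### Slow variation of iterated logarithms -/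

section Logarithms

open Set

/-- If `u / v` has a positive limit and `v` tends to infinity, then `log u` and `log v` are
asymptotically equal, as their difference is bounded. -/
theorem tendsto_log_div_log {u v : ℝ → ℝ} {c : ℝ} (hv : Tendsto v atTop atTop) (hc : 0 < c)
    (huv : Tendsto (fun t => u t / v t) atTop (𝓝 c)) :
    Tendsto (fun t => Real.log (u t) / Real.log (v t)) atTop (𝓝 1) := by
  have hlv := Real.tendsto_log_atTop.comp hv
  have h1 := ((Real.continuousAt_log hc.ne').tendsto.comp huv).div_atTop hlv
  have h2 := h1.add_const 1
  rw [zero_add] at h2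
  refine h2.congr' ?_
  filter_upwards [hv.eventually_gt_atTop 0, hlv.eventually_gt_atTop 0,
    huv.eventually_const_lt hc] with t ht1 ht2 ht3
  have ht2' : 0 < Real.log (v t) := ht2
  have hu : u t ≠ 0 := fun h => by simp [h] at ht3
  simp only [Function.comp_apply]
  rw [Real.log_div hu ht1.ne', sub_div, div_self ht2'.ne', sub_add_cancel]

theorem tendsto_one_add_div {u v : ℝ → ℝ} {c : ℝ} (hv : Tendsto v atTop atTop)
    (huv : Tendsto (fun t => u t / v t) atTop (𝓝 c)) :
    Tendsto (fun t => (1 + u t) / (1 + v t)) atTop (𝓝 c) := by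
  have h1 : Tendsto (fun t => (v t)⁻¹) atTop (𝓝 0) := tendsto_inv_atTop_zero.comp hv
  have h2 := (h1.add huv).div (h1.add_const 1) (by norm_num)
  simp only [zero_add, div_one] at h2
  refine h2.congr' ?_
  filter_upwards [hv.eventually_gt_atTop 0] with t ht
  simp only [Pi.div_apply]
  field_simp

/-- A function that tends to infinity and is slowly varying up to a nonzero factor. Taking
logarithms makes it slowly varying. -/
structure LogAdmissible (s : ℝ → ℝ) : Prop where
  tendsto : Tendsto s atTop atTop
  ratio : ∀ x, 0 < x → ∃ c, 0 < c ∧ Tendsto (fun t => s (t * x) / s t) atTop (𝓝 c)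

theorem LogAdmissible.ratio_log {s : ℝ → ℝ} (hs : LogAdmissible s) {x : ℝ} (hx : 0 < x) :
    Tendsto (fun t => Real.log (s (t * x)) / Real.log (s t)) atTop (𝓝 1) := by
  obtain ⟨c, hc, h⟩ := hs.ratio x hx
  exact tendsto_log_div_log hs.tendsto hc h

theorem LogAdmissible.log {s : ℝ → ℝ} (hs : LogAdmissible s) :
    LogAdmissible fun t => Real.log (s t) :=
  ⟨Real.tendsto_log_atTop.comp hs.tendsto, fun _ hx => ⟨1, one_pos, hs.ratio_log hx⟩⟩

theorem LogAdmissible.one_add {s : ℝ → ℝ} (hs : LogAdmissible s) :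
    LogAdmissible fun t => 1 + s t := by
  refine ⟨tendsto_atTop_add_const_left _ _ hs.tendsto, fun x hx => ?_⟩
  obtain ⟨c, hc, h⟩ := hs.ratio x hx
  exact ⟨c, hc, tendsto_one_add_div hs.tendsto h⟩

theorem logAdmissible_id : LogAdmissible fun t => t := by
  refine ⟨tendsto_id, fun x hx => ⟨x, hx, tendsto_const_nhds.congr' ?_⟩⟩
  filter_upwards [eventually_gt_atTop 0] with t ht
  rw [mul_div_cancel_left₀ _ ht.ne']

theorem logAdmissible_Ln (k : ℕ) : LogAdmissible (Ln k) := by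
  induction k with
  | zero => exact logAdmissible_id
  | succ k ih => exact ih.one_add.log

theorem logAdmissible_lnIter (k : ℕ) : LogAdmissible (lnIter k) := by
  induction k with
  | zero => exact logAdmissible_id
  | succ k ih =>
    have h : lnIter (k + 1) = fun t => Real.log (lnIter k t) :=
      funext fun t => Function.iterate_succ_apply' _ _ _
    rw [h]
    exact ih.log

/-- A power times a power of a slowly varying function. -/
theorem regVar_rpow_mul_rpow {s : ℝ → ℝ} (hs : Tendsto s atTop atTop)
    (h : ∀ x, 0 < x → Tendsto (fun t => s (t * x) / s t) atTop (𝓝 1)) (p r : ℝ) :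
    RegVar (fun L => L ^ p * s L ^ r) p := by
  constructor
  · filter_upwards [eventually_gt_atTop 0, hs.eventually_gt_atTop 0] with L h1 h2
    positivity
  · intro x hx
    have h1 := ((h x hx).rpow_const (p := r) (Or.inl one_ne_zero)).const_mul (x ^ p)
    rw [Real.one_rpow, mul_one] at h1
    refine h1.congr' ?_
    have ht : Tendsto (fun L : ℝ => L * x) atTop atTop := tendsto_id.atTop_mul_const hx
    filter_upwards [eventually_gt_atTop 0, hs.eventually_gt_atTop 0,
      (hs.comp ht).eventually_gt_atTop 0] with L h1 h2 h3
    have h3' : 0 < s (L * x) := h3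
    rw [Real.div_rpow h3'.le h2.le, Real.mul_rpow h1.le hx.le]
    field_simp

theorem regVar_Ln (p r : ℝ) {k : ℕ} (hk : 1 ≤ k) : RegVar (fun L => L ^ p * Ln k L ^ r) p := by
  obtain ⟨k, rfl⟩ := Nat.exists_eq_add_of_le' hk
  exact regVar_rpow_mul_rpow (s := Ln (k + 1)) (logAdmissible_Ln _).tendsto
    (fun x hx => (logAdmissible_Ln k).one_add.ratio_log hx) p r

theorem regVar_lnIter (p r : ℝ) {k : ℕ} (hk : 1 ≤ k) :
    RegVar (fun L => L ^ p * lnIter k L ^ r) p := by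
  obtain ⟨k, rfl⟩ := Nat.exists_eq_add_of_le' hk
  refine regVar_rpow_mul_rpow (logAdmissible_lnIter _).tendsto (fun x hx => ?_) p r
  have h : lnIter (k + 1) = fun t => Real.log (lnIter k t) :=
    funext fun t => Function.iterate_succ_apply' _ _ _
  rw [h]
  exact (logAdmissible_lnIter k).ratio_log hx

end Logarithms

/-! ### Substitution of the Lambert function -/

section Lambert

open Set

theorem mul_exp_strictMonoOn : StrictMonoOn (fun x : ℝ => x * Real.exp x) (Ici 0) := by
  intro x hx y _ hxy
  have hx' : 0 ≤ x := hx
  exact mul_lt_mul'' hxy (Real.exp_lt_exp.mpr hxy) hx' (Real.exp_pos _).le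

theorem lambertW₀_mul_exp {x : ℝ} (hx : 0 ≤ x) : lambertW₀ (x * Real.exp x) = x := by
  have h := lambertW₀_spec (y := x * Real.exp x) (by positivity)
  exact mul_exp_strictMonoOn.injOn h.1 hx h.2

theorem tendsto_lambertW₀ : Tendsto lambertW₀ atTop atTop := by
  refine tendsto_atTop.mpr fun b => ?_
  filter_upwards [eventually_ge_atTop (max b 0 * Real.exp (max b 0)), eventually_ge_atTop 0]
    with L hL hL0
  have h := lambertW₀_spec hL0
  rw [← h.2] at hL
  exact (le_max_left b 0).trans ((mul_exp_strictMonoOn.le_iff_le (le_max_right b 0) h.1).mp hL)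

theorem isBigOENN_of_tendsto_div {F : ℝ → ℝ≥0∞} {f g : ℝ → ℝ} (hf : ∀ᶠ L in atTop, 0 < f L)
    (hg : ∀ᶠ L in atTop, 0 < g L) (h : Tendsto (fun L => f L / g L) atTop (𝓝 1))
    (hF : IsBigOENN atTop F f) : IsBigOENN atTop F g := by
  rw [isBigOENN_iff hf] at hF
  rw [isBigOENN_iff hg]
  obtain ⟨C, hC, hF⟩ := hF
  refine ⟨C * 2, by positivity, ?_⟩
  filter_upwards [hF, hg, h.eventually_le_const one_lt_two] with L h1 h2 h3
  refine h1.trans (ENNReal.ofReal_le_ofReal ?_)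
  rw [div_le_iff₀ h2] at h3
  rw [mul_assoc]
  gcongr

/-- `Ln 1 L = log (1 + L)` may be replaced by `log L`. -/
theorem isBigOENN_Ln_one_iff (N : ℝ → ℝ≥0∞) (p r : ℝ) :
    IsBigOENN atTop N (fun L => L ^ p * Ln 1 L ^ r) ↔
      IsBigOENN atTop N (fun L => L ^ p * Real.log L ^ r) := by
  have hid : Tendsto (fun t : ℝ => (1 + t) / t) atTop (𝓝 1) := by
    have h1 := (tendsto_inv_atTop_zero (𝕜 := ℝ)).add_const 1
    rw [zero_add] at h1
    refine h1.congr' ?_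
    filter_upwards [eventually_gt_atTop 0] with t ht
    field_simp
  have hlog := tendsto_log_div_log tendsto_id one_pos hid
  have hpos1 := (regVar_Ln p r le_rfl).eventually_pos
  have hpos2 : ∀ᶠ L : ℝ in atTop, 0 < L ^ p * Real.log L ^ r := by
    filter_upwards [eventually_gt_atTop 1] with L hL
    have := Real.log_pos hL
    positivity
  have hratio : Tendsto (fun L : ℝ => (L ^ p * Ln 1 L ^ r) / (L ^ p * Real.log L ^ r)) atTop
      (𝓝 1) := by
    have h1 := hlog.rpow_const (p := r) (Or.inl one_ne_zero)
    rw [Real.one_rpow] at h1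
    refine h1.congr' ?_
    filter_upwards [eventually_gt_atTop 1] with L hL
    have h2 := Real.log_pos hL
    have h3 : 0 < Real.log (1 + L) := Real.log_pos (by linarith)
    have h4 : (0 : ℝ) < L ^ p := by positivity
    rw [id, Real.div_rpow h3.le h2.le, mul_div_mul_left _ _ h4.ne']
    rfl
  refine ⟨isBigOENN_of_tendsto_div hpos1 hpos2 hratio,
    isBigOENN_of_tendsto_div hpos2 hpos1 ?_⟩
  have h1 := hratio.inv₀ one_ne_zero
  rw [inv_one] at h1
  exact h1.congr fun L => inv_div _ _

/-- The substitution `L = x * exp x`, `x = log l` turns the bound by `l ^ p * log l ^ r` into a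
bound along the Lambert function. -/
theorem isBigOENN_lambertW₀_iff (N : ℝ → ℝ≥0∞) (p r : ℝ) :
    IsBigOENN atTop (fun L => N (Real.exp (lambertW₀ L)))
        (fun L => L ^ r * Real.exp ((p - r) * lambertW₀ L)) ↔
      IsBigOENN atTop N (fun L => L ^ p * Real.log L ^ r) := by
  have hpos1 : ∀ᶠ L : ℝ in atTop, 0 < L ^ r * Real.exp ((p - r) * lambertW₀ L) := by
    filter_upwards [eventually_gt_atTop 0] with L hL
    positivity
  have hpos2 : ∀ᶠ L : ℝ in atTop, 0 < L ^ p * Real.log L ^ r := by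
    filter_upwards [eventually_gt_atTop 1] with L hL
    have := Real.log_pos hL
    positivity
  have hW : Tendsto (fun L => Real.exp (lambertW₀ L)) atTop atTop :=
    Real.tendsto_exp_atTop.comp tendsto_lambertW₀
  have hinv : Tendsto (fun l : ℝ => Real.log l * Real.exp (Real.log l)) atTop atTop :=
    (tendsto_id.atTop_mul_atTop₀ Real.tendsto_exp_atTop).comp Real.tendsto_log_atTop
  have heq : ∀ L : ℝ, 0 < L → L ^ r * Real.exp ((p - r) * lambertW₀ L)
      = Real.exp (lambertW₀ L) ^ p * Real.log (Real.exp (lambertW₀ L)) ^ r := by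
    intro L hL
    obtain ⟨h1, h2⟩ := lambertW₀_spec hL.le
    have h3 : L ^ r = lambertW₀ L ^ r * Real.exp (lambertW₀ L * r) := by
      conv_lhs => rw [← h2]
      rw [Real.mul_rpow h1 (Real.exp_pos _).le, ← Real.exp_mul]
    rw [h3, Real.log_exp, ← Real.exp_mul, mul_assoc, ← Real.exp_add, mul_comm]
    congr 2
    ring
  rw [isBigOENN_iff hpos1, isBigOENN_iff hpos2]
  refine exists_congr fun C => and_congr_right fun _ => ⟨fun h => ?_, fun h => ?_⟩
  · filter_upwards [hinv.eventually h, hinv.eventually_gt_atTop 0, eventually_ge_atTop 1]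
      with l h1 h2 h3
    rwa [heq _ h2, lambertW₀_mul_exp (Real.log_nonneg h3), Real.exp_log (by linarith)] at h1
  · filter_upwards [hW.eventually h, eventually_gt_atTop 0] with L h1 h2
    rwa [heq L h2]

end Lambert

/-! ### Ordered enumeration of eigenvalues -/

section Enumeration

open Set

variable {ι : Type*} {a : ι → ℝ}

/-- An infinite family of real numbers with finite counting function can be enumerated in
non-decreasing order: the `k`-th term is the least member `a i` such that more than `k` members
are at most `a i`. -/
theorem exists_monotone_enumeration [Infinite ι] (hfin : ∀ L, ({i | a i ≤ L} : Set ι).Finite) :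
    ∃ ev : ℕ → ℝ, Monotone ev ∧ ∀ μ, {k | ev k = μ}.encard = ({i | a i = μ} : Set ι).encard := by
  have hex : ∀ k : ℕ, ∃ i, k < ({j | a j ≤ a i} : Set ι).ncard ∧
      ∀ l, k < ({j | a j ≤ a l} : Set ι).ncard → a i ≤ a l := by
    intro k
    obtain ⟨t, ht⟩ := Infinite.exists_subset_card_eq ι (k + 1)
    have htne : t.Nonempty := Finset.card_pos.mp (by omega)
    obtain ⟨m, hm, hm'⟩ := t.exists_max_image a htne
    have hkm : k < ({j | a j ≤ a m} : Set ι).ncard := by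
      have h1 : (t : Set ι) ⊆ {j | a j ≤ a m} := fun j hj => hm' j hj
      have h2 := ncard_le_ncard h1 (hfin _)
      rw [ncard_coe_finset, ht] at h2
      omega
    obtain ⟨i, hi, hi'⟩ := Set.exists_min_image
      ({l | a l ≤ a m} ∩ {l | k < ({j | a j ≤ a l} : Set ι).ncard}) a
      ((hfin _).inter_of_left _) ⟨m, le_refl (a m), hkm⟩
    refine ⟨i, hi.2, fun l hl => ?_⟩
    rcases le_total (a l) (a m) with h | h
    · exact hi' l ⟨h, hl⟩
    · exact (show a i ≤ a m from hi.1).trans h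
  choose e he1 he2 using hex
  -- Membership of `e k` in an initial segment of the family is decided by its cardinality.
  have hlow : ∀ (k : ℕ) (s : Set ι), s.Finite → (∀ i j, a i ≤ a j → j ∈ s → i ∈ s) →
      (e k ∈ s ↔ k < s.ncard) := by
    intro k s hs hs'
    constructor
    · intro h
      exact (he1 k).trans_le (ncard_le_ncard (fun i hi => hs' i _ hi h) hs)
    · intro h
      have hne : s.Nonempty := (ncard_pos hs).mp (by omega)
      obtain ⟨m, hm, hm'⟩ := Set.exists_max_image s a hs hne
      have h1 : s = {j | a j ≤ a m} :=
        Subset.antisymm (fun j hj => hm' j hj) (fun j hj => hs' j m hj hm)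
      rw [h1] at h
      exact hs' _ m (he2 k m h) hm
  have hcard : ∀ s : Set ι, s.Finite → (∀ i j, a i ≤ a j → j ∈ s → i ∈ s) →
      {k | e k ∈ s}.encard = s.encard := by
    intro s hs hs'
    have h1 : {k | e k ∈ s} = (Finset.range s.ncard : Set ℕ) := by
      ext k
      simp [hlow k s hs hs']
    rw [h1, encard_coe_eq_coe_finsetCard, Finset.card_range, hs.cast_ncard_eq]
  refine ⟨fun k => a (e k), fun k l hkl => he2 k _ (hkl.trans_lt (he1 l)), fun μ => ?_⟩
  have hlt : ({i | a i < μ} : Set ι).Finite := (hfin μ).subset fun i (hi : a i < μ) => hi.le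
  have h1 := hcard {i | a i ≤ μ} (hfin μ) fun i j hij hj => hij.trans hj
  have h2 := hcard {i | a i < μ} hlt fun i j hij hj => lt_of_le_of_lt hij hj
  have h3 : ({i | a i = μ} : Set ι).encard + ({i | a i < μ} : Set ι).encard
      = ({i | a i ≤ μ} : Set ι).encard := by
    rw [← encard_union_eq]
    · congr 1; ext i; exact le_iff_eq_or_lt.symm
    · exact disjoint_left.mpr fun i (hi : a i = μ) (hi' : a i < μ) => hi'.ne hi
  have h4 : {k | a (e k) = μ}.encard + {k | e k ∈ {i | a i < μ}}.encard
      = {k | e k ∈ {i | a i ≤ μ}}.encard := by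
    rw [← encard_union_eq]
    · congr 1; ext i; exact le_iff_eq_or_lt.symm
    · exact disjoint_left.mpr fun i (hi : a (e i) = μ) (hi' : a (e i) < μ) => hi'.ne hi
  rw [h1, h2, ← h3] at h4
  exact (ENat.add_left_injective_of_ne_top hlt.encard_lt_top.ne) h4

variable {p : ℝ}

theorem count_lt_top_of_eventually {f : ℝ → ℝ}
    (h : ∀ᶠ L in atTop, count a L ≤ ENNReal.ofReal (f L)) (L : ℝ) : count a L < ⊤ := by
  obtain ⟨M, hM, hLM⟩ := (h.and (eventually_ge_atTop L)).exists
  exact (count_mono hLM).trans_lt (hM.trans_lt ENNReal.ofReal_lt_top)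

theorem finite_of_count_lt_top {L : ℝ} (h : count a L < ⊤) : ({i | a i ≤ L} : Set ι).Finite := by
  rw [count, ENat.toENNReal_lt_top] at h
  exact encard_lt_top_iff.mp h

/-- A non-decreasing sequence satisfies `j + 1 ≤ count ev (ev j)`, so that an upper bound on the
counting function is a lower bound on the terms. -/
theorem isBigO_inv_of_count_le (hp : 0 < p) {ev : ℕ → ℝ} (hev : Monotone ev) {C : ℝ} (hC : 0 < C)
    (h : ∀ᶠ L in atTop, count ev L ≤ ENNReal.ofReal (C * L ^ p)) :
    (∀ᶠ j in atTop, ev j ≠ 0) ∧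
      (fun j : ℕ => (ev j)⁻¹) =O[atTop] (fun j : ℕ => ((j : ℝ) + 1) ^ (-(1 / p))) := by
  have htop : Tendsto ev atTop atTop := by
    refine tendsto_atTop.mpr fun b => ?_
    have h1 := (finite_of_count_lt_top (count_lt_top_of_eventually h b)).eventually_cofinite_notMem
    rw [Nat.cofinite_eq_atTop] at h1
    exact h1.mono fun j hj => (not_le.mp hj).le
  refine ⟨(htop.eventually_gt_atTop 0).mono fun j hj => hj.ne', ?_⟩
  refine Asymptotics.IsBigO.of_bound (C ^ (1 / p)) ?_
  filter_upwards [htop.eventually h, htop.eventually_gt_atTop 0] with j h1 h2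
  have h3 : ((j : ℝ) + 1) ≤ C * ev j ^ p := by
    have h4 : ((j + 1 : ℕ) : ℝ≥0∞) ≤ count ev (ev j) := by
      have h5 : ((Finset.range (j + 1) : Finset ℕ) : Set ℕ) ⊆ {k | ev k ≤ ev j} := by
        intro k hk
        exact hev (Nat.lt_succ_iff.mp (Finset.mem_range.mp hk))
      have h6 := encard_le_encard h5
      rw [encard_coe_eq_coe_finsetCard, Finset.card_range] at h6
      rw [count]
      exact_mod_cast ENat.toENNReal_le.mpr h6
    have h7 := h4.trans h1
    rw [← ENNReal.ofReal_natCast, ENNReal.ofReal_le_ofReal_iff (by positivity)] at h7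
    exact_mod_cast h7
  have hj : (0 : ℝ) < (j : ℝ) + 1 := by positivity
  rw [Real.norm_of_nonneg (inv_pos.mpr h2).le, Real.norm_of_nonneg (by positivity),
    Real.rpow_neg hj.le, ← div_eq_mul_inv, inv_le_comm₀ h2 (by positivity), inv_div,
    div_le_iff₀ (by positivity)]
  calc ((j : ℝ) + 1) ^ (1 / p) ≤ (C * ev j ^ p) ^ (1 / p) := by gcongr
    _ = ev j * C ^ (1 / p) := by
      rw [Real.mul_rpow hC.le (by positivity), ← Real.rpow_mul h2.le, mul_one_div_cancel hp.ne',
        Real.rpow_one, mul_comm]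

theorem exists_count_le_of_isBigO_inv (hp : 0 < p) {ev : ℕ → ℝ} (hev : Monotone ev)
    (hne : ∀ᶠ j in atTop, ev j ≠ 0)
    (h : (fun j : ℕ => (ev j)⁻¹) =O[atTop] (fun j : ℕ => ((j : ℝ) + 1) ^ (-(1 / p)))) :
    ∃ C, 0 < C ∧ ∀ᶠ L in atTop, count ev L ≤ ENNReal.ofReal (C * L ^ p) := by
  obtain ⟨C, hC, hbd⟩ := h.exists_pos
  have hp' : 0 < 1 / p := by positivity
  have hbd' : ∀ᶠ j : ℕ in atTop, ((j : ℝ) + 1) ^ (1 / p) ≤ C * |ev j| := by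
    filter_upwards [hbd.bound, hne] with j h1 h2
    have hj : (0 : ℝ) < (j : ℝ) + 1 := by positivity
    have h3 : 0 < |ev j| := abs_pos.mpr h2
    rwa [norm_inv, Real.norm_eq_abs, Real.norm_of_nonneg (by positivity), Real.rpow_neg hj.le,
      ← div_eq_mul_inv, inv_le_comm₀ h3 (by positivity), inv_div, div_le_iff₀ hC,
      mul_comm] at h1
  have hlarge : ∀ᶠ j : ℕ in atTop, C * |ev 0| < ((j : ℝ) + 1) ^ (1 / p) :=
    ((tendsto_rpow_atTop hp').comp (tendsto_atTop_add_const_right _ 1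
      tendsto_natCast_atTop_atTop)).eventually_gt_atTop _
  obtain ⟨J, hJ⟩ := eventually_atTop.mp (hbd'.and hlarge)
  refine ⟨J + C ^ p, by positivity, ?_⟩
  filter_upwards [eventually_ge_atTop 1] with L hL
  have hsub : {j | ev j ≤ L} ⊆ (Finset.range (J + ⌊(C * L) ^ p⌋₊) : Set ℕ) := by
    intro j hj
    have hj' : ev j ≤ L := hj
    rw [Finset.coe_range, mem_Iio]
    by_contra hcon
    obtain ⟨h1, h2⟩ := hJ j (by omega)
    -- A non-positive `ev j` would lie in the bounded range `[ev 0, 0]`.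
    have hpos : 0 < ev j := by
      by_contra hneg
      have h3 : |ev j| ≤ |ev 0| := by
        have := hev (Nat.zero_le j)
        rw [abs_of_nonpos (not_lt.mp hneg), abs_of_nonpos (this.trans (not_lt.mp hneg))]
        linarith
      have := mul_le_mul_of_nonneg_left h3 hC.le
      linarith
    rw [abs_of_pos hpos] at h1
    have h4 : ((j : ℝ) + 1) ^ (1 / p) ≤ C * L := h1.trans (by gcongr)
    have h5 : ((j : ℝ) + 1) ≤ (C * L) ^ p := by
      have := Real.rpow_le_rpow (by positivity) h4 hp.le
      rwa [← Real.rpow_mul (by positivity), one_div_mul_cancel hp.ne', Real.rpow_one] at this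
    have h6 : j + 1 ≤ ⌊(C * L) ^ p⌋₊ := Nat.le_floor (by push_cast; exact h5)
    omega
  have h1 := encard_le_encard hsub
  rw [encard_coe_eq_coe_finsetCard, Finset.card_range] at h1
  have h2 : count ev L ≤ ((J + ⌊(C * L) ^ p⌋₊ : ℕ) : ℝ≥0∞) := by
    rw [count]
    exact_mod_cast ENat.toENNReal_le.mpr h1
  refine h2.trans ?_
  rw [← ENNReal.ofReal_natCast]
  refine ENNReal.ofReal_le_ofReal ?_
  push_cast
  have h3 : (⌊(C * L) ^ p⌋₊ : ℝ) ≤ C ^ p * L ^ p :=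
    (Nat.floor_le (by positivity)).trans_eq (Real.mul_rpow hC.le (by linarith))
  have h4 : (1 : ℝ) ≤ L ^ p := Real.one_le_rpow hL hp.le
  have h5 : (J : ℝ) ≤ J * L ^ p := le_mul_of_one_le_right (by positivity) h4
  linarith

end Enumeration

/-! ### Transfer to the semigroup -/

section Transfer

theorem map_inv_nhdsGT_zero : map (fun t : ℝ => t⁻¹) (𝓝[>] 0) = atTop := inv_nhdsGT_zero

variable {ι : Type*} {a : ι → ℝ} {F : ℝ → ℝ≥0∞} {f g : ℝ → ℝ}

/-- The substitution `t = 1 / L` for quotients by a gauge function. -/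
theorem div_eventuallyEq_comp_inv (hF : ∀ t, 0 ≤ t → F t = heatSum a t)
    (hg : ∀ t, 0 < t → g t = f t⁻¹) :
    (fun t => F t / ENNReal.ofReal (g t)) =ᶠ[𝓝[>] 0]
      (fun L => heatSum a L⁻¹ / ENNReal.ofReal (f L)) ∘ fun t => t⁻¹ := by
  filter_upwards [self_mem_nhdsWithin] with t ht
  rw [Function.comp_apply, inv_inv, hF t (le_of_lt ht), hg t ht]

theorem isBigOENN_nhdsGT_iff (hF : ∀ t, 0 ≤ t → F t = heatSum a t)
    (hg : ∀ t, 0 < t → g t = f t⁻¹) :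
    IsBigOENN (𝓝[>] 0) F g ↔ IsBigOENN atTop (fun L => heatSum a L⁻¹) f := by
  unfold IsBigOENN
  rw [limsup_congr (div_eventuallyEq_comp_inv hF hg), limsup_comp, map_inv_nhdsGT_zero]

theorem liminf_nhdsGT_eq (hF : ∀ t, 0 ≤ t → F t = heatSum a t)
    (hg : ∀ t, 0 < t → g t = f t⁻¹) :
    liminf (fun t => F t / ENNReal.ofReal (g t)) (𝓝[>] 0)
      = liminf (fun L => heatSum a L⁻¹ / ENNReal.ofReal (f L)) atTop := by
  rw [liminf_congr (div_eventuallyEq_comp_inv hF hg), liminf_comp, map_inv_nhdsGT_zero]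

theorem tendsto_nhdsGT_iff (hF : ∀ t, 0 ≤ t → F t = heatSum a t)
    (hg : ∀ t, 0 < t → g t = f t⁻¹) (c : ℝ≥0∞) :
    Tendsto (fun t => F t / ENNReal.ofReal (g t)) (𝓝[>] 0) (𝓝 c) ↔
      Tendsto (fun L => heatSum a L⁻¹ / ENNReal.ofReal (f L)) atTop (𝓝 c) := by
  rw [tendsto_congr' (div_eventuallyEq_comp_inv hF hg), ← tendsto_map'_iff, map_inv_nhdsGT_zero]

/-- Finiteness of all exponential sums together with an `O`-bound at `0` amounts to an `O`-bound on
the counting function. -/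
theorem RegVar.heatSum_isBigO_iff [Countable ι] {p ω : ℝ} (hω : 0 ≤ ω) (ha : ∀ i, -ω ≤ a i)
    (hf : RegVar f p) (hF : ∀ t, 0 ≤ t → F t = heatSum a t) (hg : ∀ t, 0 < t → g t = f t⁻¹) :
    ((∀ t, 0 < t → F t < ⊤) ∧ IsBigOENN (𝓝[>] 0) F g) ↔ IsBigOENN atTop (count a) f := by
  rw [isBigOENN_nhdsGT_iff hF hg, isBigOENN_iff hf.eventually_pos, isBigOENN_iff hf.eventually_pos]
  constructor
  · rintro ⟨-, C, hC, h⟩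
    refine ⟨Real.exp 1 * C, by positivity, ?_⟩
    filter_upwards [h, eventually_gt_atTop 0] with L h1 h2
    have h3 := count_le_heatSum (a := a) 1 h2
    rw [one_mul] at h3
    rw [mul_assoc, ENNReal.ofReal_mul (Real.exp_pos _).le]
    exact h3.trans (mul_le_mul_right h1 _)
  · rintro ⟨C, hC, h⟩
    obtain ⟨K, hK, h'⟩ := hf.exists_heatSum_le hω ha hC h
    refine ⟨fun t ht => ?_, K, hK, h'⟩
    obtain ⟨L, hL1, hL2⟩ := (h'.and (eventually_ge_atTop t⁻¹)).exists
    rw [hF t ht.le]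
    exact heatSum_lt_top_of_le ha (inv_le_of_inv_le₀ ht hL2) (hL1.trans_lt ENNReal.ofReal_lt_top)

end Transfer

section Eigenvalues

variable {H : Type*} [NormedAddCommGroup H] [InnerProductSpace ℂ H] {T : H →ₗ.[ℂ] H}
  {ι : Type*} {a : ι → ℝ}

theorem eigenCount_eq_count
    (hT : ∀ μ, eigenMult T μ = ({i | a i = μ} : Set ι).encard) : eigenCount T = count a := by
  funext L
  rw [← tsum_encard_fiber_Iic]
  exact tsum_congr fun μ => by rw [hT]

theorem IsEigenvalueSequence.eigenCount_eq {ev : ℕ → ℝ} (h : IsEigenvalueSequence T ev) :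
    eigenCount T = count ev :=
  eigenCount_eq_count fun μ => (h.card_eq μ).symm

theorem isBigOENN_eigenCount_iff_exists_isEigenvalueSequence [Infinite ι]
    (hT : ∀ μ, eigenMult T μ = ({i | a i = μ} : Set ι).encard) {p : ℝ} (hp : 0 < p) :
    IsBigOENN atTop (eigenCount T) (fun L => L ^ p) ↔
      ∃ ev : ℕ → ℝ, IsEigenvalueSequence T ev ∧ (∀ᶠ j in atTop, ev j ≠ 0) ∧
        (fun j : ℕ => (ev j)⁻¹) =O[atTop] (fun j : ℕ => ((j : ℝ) + 1) ^ (-(1 / p))) := by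
  have hpos : ∀ᶠ L : ℝ in atTop, 0 < L ^ p := by
    filter_upwards [eventually_gt_atTop 0] with L hL
    positivity
  rw [isBigOENN_iff hpos]
  constructor
  · rintro ⟨C, hC, h⟩
    rw [eigenCount_eq_count hT] at h
    obtain ⟨ev, hev, hcard⟩ := exists_monotone_enumeration (a := a)
      fun L => finite_of_count_lt_top (count_lt_top_of_eventually h L)
    have hseq : IsEigenvalueSequence T ev := ⟨hev, fun μ => by rw [hcard, hT]⟩
    rw [← eigenCount_eq_count hT, hseq.eigenCount_eq] at h
    exact ⟨ev, hseq, isBigO_inv_of_count_le hp hev hC h⟩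
  · rintro ⟨ev, hseq, hne, h⟩
    rw [hseq.eigenCount_eq]
    exact exists_count_le_of_isBigO_inv hp hseq.monotone hne h

end Eigenvalues

end GibbsKaramata

theorem corollary3p2 {H : Type*} [NormedAddCommGroup H] [InnerProductSpace ℂ H] [CompleteSpace H]
    [TopologicalSpace.SeparableSpace H] (hH : ¬ FiniteDimensional ℂ H)
    (A : H →ₗ.[ℂ] H) (U : ℝ → H →L[ℂ] H)
    (hU : GibbsKaramata.IsC0Semigroup U) (hgen : GibbsKaramata.IsGenerator A U)
    (hnormal : GibbsKaramata.IsNormalOp A) (hres : GibbsKaramata.HasCompactResolvent A) :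
    -- part (a)
    (∀ (p r : ℝ) (k : ℕ), (0 < p ∨ (p = 0 ∧ 0 < r)) → 1 ≤ k →
      -- (i) iff (ii)
      ((GibbsKaramata.IsGibbs U ∧
          GibbsKaramata.IsBigOENN (𝓝[>] 0) (fun t => GibbsKaramata.traceNorm (U t))
            (fun t => t ^ (-p) * (GibbsKaramata.Ln k t⁻¹) ^ r)) ↔
        (GibbsKaramata.realPartOp A ≠ 0 ∧
          GibbsKaramata.IsBigOENN atTop (GibbsKaramata.eigenCount (GibbsKaramata.realPartOp A))
            (fun L => L ^ p * (GibbsKaramata.Ln k L) ^ r))) ∧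
      -- (i) iff (ii'), for k = 1
      (k = 1 →
        ((GibbsKaramata.IsGibbs U ∧
            GibbsKaramata.IsBigOENN (𝓝[>] 0) (fun t => GibbsKaramata.traceNorm (U t))
              (fun t => t ^ (-p) * (GibbsKaramata.Ln k t⁻¹) ^ r)) ↔
          (GibbsKaramata.realPartOp A ≠ 0 ∧
            GibbsKaramata.IsBigOENN atTop
              (fun L => GibbsKaramata.eigenCount (GibbsKaramata.realPartOp A)
                (Real.exp (GibbsKaramata.lambertW₀ L)))
              (fun L => L ^ r * Real.exp ((p - r) * GibbsKaramata.lambertW₀ L))))) ∧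
      -- (i) iff (iii), for r = 0
      (r = 0 →
        ((GibbsKaramata.IsGibbs U ∧
            GibbsKaramata.IsBigOENN (𝓝[>] 0) (fun t => GibbsKaramata.traceNorm (U t))
              (fun t => t ^ (-p) * (GibbsKaramata.Ln k t⁻¹) ^ r)) ↔
          (GibbsKaramata.realPartOp A ≠ 0 ∧
            ∃ ev : ℕ → ℝ, GibbsKaramata.IsEigenvalueSequence (GibbsKaramata.realPartOp A) ev ∧
              (∀ᶠ j in atTop, ev j ≠ 0) ∧
              (fun j : ℕ => (ev j)⁻¹) =O[atTop] (fun j : ℕ => ((j : ℝ) + 1) ^ (-(1 / p))))))) ∧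
    -- part (b)
    (∀ (p : ℝ) (f : ℝ → ℝ), 0 ≤ p → GibbsKaramata.IsRegularlyVarying f p →
      (∀ c : ℝ,
        ENNReal.ofReal c ≤ liminf (fun L =>
          GibbsKaramata.eigenCount (GibbsKaramata.realPartOp A) L / ENNReal.ofReal (f L)) atTop →
        ENNReal.ofReal (c * Real.Gamma (1 + p)) ≤ liminf (fun t =>
          GibbsKaramata.traceNorm (U t) / ENNReal.ofReal (f t⁻¹)) (𝓝[>] 0)) ∧
      (0 < liminf (fun t =>
          GibbsKaramata.traceNorm (U t) / ENNReal.ofReal (f t⁻¹)) (𝓝[>] 0) →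
        GibbsKaramata.IsBigOENN (𝓝[>] 0) (fun t => GibbsKaramata.traceNorm (U t))
          (fun t => f t⁻¹) →
        0 < liminf (fun L =>
          GibbsKaramata.eigenCount (GibbsKaramata.realPartOp A) L / ENNReal.ofReal (f L)) atTop)) ∧
    -- part (c)
    (∀ (p r : ℝ) (k : ℕ), (0 < p ∨ (p = 0 ∧ 0 < r)) → 1 ≤ k → ∀ C : ℝ, 0 ≤ C →
      (Tendsto (fun L => GibbsKaramata.eigenCount (GibbsKaramata.realPartOp A) L /
          ENNReal.ofReal (L ^ p * (GibbsKaramata.lnIter k L) ^ r)) atTop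
          (𝓝 (ENNReal.ofReal C)) ↔
        Tendsto (fun t => GibbsKaramata.traceNorm (U t) /
          ENNReal.ofReal (t ^ (-p) * (GibbsKaramata.lnIter k t⁻¹) ^ r)) (𝓝[>] 0)
          (𝓝 (ENNReal.ofReal (Real.Gamma (1 + p) * C))))) := by
  obtain ⟨ι, a, ω, hcount, hinf, hω, ha, htr, hmult, hzero⟩ :=
    GibbsKaramata.exists_spectral_data hH hU hgen hnormal hres
  have hN := GibbsKaramata.eigenCount_eq_count hmult
  -- If the real part vanished, all eigenvalues would be counted at level `0`.
  have hne : ∀ f : ℝ → ℝ, (∀ᶠ L in atTop, 0 < f L) →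
      GibbsKaramata.IsBigOENN atTop (GibbsKaramata.count a) f → GibbsKaramata.realPartOp A ≠ 0 := by
    intro f hf hO h0
    obtain ⟨C, -, h⟩ := (GibbsKaramata.isBigOENN_iff hf).mp hO
    have h1 := GibbsKaramata.count_lt_top_of_eventually h 0
    rw [GibbsKaramata.count_eq_top_of_forall_eq_zero (hzero h0) le_rfl] at h1
    exact lt_irrefl _ h1
  have hgauge : ∀ (p r : ℝ) (s : ℝ → ℝ) (t : ℝ), 0 < t →
      t ^ (-p) * s t⁻¹ ^ r = (fun L => L ^ p * s L ^ r) t⁻¹ := by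
    intro p r s t ht
    simp only [Real.inv_rpow ht.le, Real.rpow_neg ht.le]
  refine ⟨fun p r k hpr hk => ?_, fun p f hp hf => ?_, fun p r k hpr hk C hC => ?_⟩
  · have hf := GibbsKaramata.regVar_Ln p r hk
    have key := hf.heatSum_isBigO_iff hω ha htr (hgauge p r (GibbsKaramata.Ln k))
    have key' := and_iff_right_of_imp (hne _ hf.eventually_pos)
    rw [hN]
    unfold GibbsKaramata.IsGibbs
    refine ⟨key.trans key'.symm, ?_, ?_⟩
    · rintro rfl
      rw [GibbsKaramata.isBigOENN_lambertW₀_iff, ← GibbsKaramata.isBigOENN_Ln_one_iff]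
      exact key.trans key'.symm
    · rintro rfl
      have hp : 0 < p := hpr.resolve_right fun h => lt_irrefl _ h.2
      have h1 := GibbsKaramata.isBigOENN_eigenCount_iff_exists_isEigenvalueSequence hmult hp
      rw [hN] at h1
      rw [← h1]
      simp only [Real.rpow_zero, mul_one] at key key' ⊢
      exact key.trans key'.symm
  · have hreg := hf.regVar
    have hl := GibbsKaramata.liminf_nhdsGT_eq (g := fun t => f t⁻¹) htr fun t _ => rfl
    refine ⟨fun c hc => ?_, fun hpos hO => ?_⟩
    · rw [hN] at hc
      rw [hl]
      exact hreg.le_liminf_heatSum hp hc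
    · rw [hl] at hpos
      rw [GibbsKaramata.isBigOENN_nhdsGT_iff htr fun t _ => rfl,
        GibbsKaramata.isBigOENN_iff hreg.eventually_pos] at hO
      obtain ⟨C, hC, hO⟩ := hO
      rw [hN]
      exact hreg.liminf_count_pos hω ha hpos hC hO
  · have hf := GibbsKaramata.regVar_lnIter p r hk
    have hp : 0 ≤ p := hpr.elim le_of_lt fun h => h.1.ge
    rw [hN, GibbsKaramata.tendsto_nhdsGT_iff (f := fun L => L ^ p * GibbsKaramata.lnIter k L ^ r) htr
      (hgauge p r (GibbsKaramata.lnIter k))]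
    exact ⟨hf.tendsto_heatSum hω ha hp, hf.tendsto_count ha hp hC⟩
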